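/- Fix $\gamma>0$ and $\sigma>0$, and let $X_{ij}$ ($i,j\ge 1$) be independent random variables, $X_{ij}$ (the $j$-th observation of alternative $i$) being normal with mean $\mu_i$ and variance $\sigma^2$, where $\mu_1-\mu_i=\gamma$ for all $i\ge 2$ (slippage configuration with common variance). Put $\bar X_i(n)=\frac1n\sum_{j=1}^n X_{ij}$, let $\Phi$ be the standard normal distribution function, and for $x>0$ let $$C(x)=\exp\Big(\sum_{n=1}^{\infty}\tfrac1n\,\Phi(-\sqrt n\,x)\Big).$$ The greedy procedure with $k$ alternatives $1,\dots,k$ and budget $B$ takes one observation from each alternative; then, as long as fewer than $B$ observations have been taken, it takes the next observation from an alternative with the largest current sample mean; finally it selects an alternative with the largest current sample mean (ties are broken by an arbitrary fixed rule). Let $\mathrm{PCS}$ be the probability that it selects alternative $1$. For every $c>C(\gamma/\sigma)$ and $B=ck$ (rounded down to an integer), the limit $\lim_{k\to\infty}\mathrm{PCS}$ exists, and $$\lim_{k\to\infty}\mathrm{PCS}\;\le\;\Pr\Big\{\min_{n\ge1}\bar X_1(n)>\mu_1-\gamma\Big\}=\Big[C\Big(\frac{\gamma}{\sigma}\Big)\Big]^{-1}<1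 .$$ Consequently the greedy procedure is not consistent: under this configuration it is not true that for every $\alpha\in(0,1)$ there is a constant $c>0$ with $\liminf_{k\to\infty}\mathrm{PCS}\ge\alpha$ for $B=ck$ (rounded down to an integer). -/

import Mathlib

open MeasureTheory ProbabilityTheory Filter Topology
open scoped NNReal

/-- `runningMean z n` is the average of the first `n` terms `z 0, …, z (n - 1)` of the sequence `z`
(used for `n ≥ 1` only). -/
noncomputable def runningMean (z : ℕ → ℝ) (n : ℕ) : ℝ :=
  (∑ j ∈ Finset.range n, z j) / n

/-- The running averages `z̄(n)`, `n ≥ 1`, have a minimum, and this minimum exceeds `a`. -/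
def MinRunningMeanGT (z : ℕ → ℝ) (a : ℝ) : Prop :=
  ∃ m : ℝ, IsLeast {y | ∃ n : ℕ, 1 ≤ n ∧ y = runningMean z n} m ∧ a < m

/-- The cumulative distribution function `Φ` of the standard normal distribution. -/
noncomputable def stdNormalCDF (x : ℝ) : ℝ :=
  cdf (gaussianReal 0 1) x

/-- `C(x) = exp (∑_{n ≥ 1} Φ(-√n x) / n)`, for `x > 0`. -/
noncomputable def boundaryC (x : ℝ) : ℝ :=
  Real.exp (∑' n : ℕ, 1 / ((n : ℝ) + 1) * stdNormalCDF (-(Real.sqrt ((n : ℝ) + 1) * x)))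

/-- `sel` selects, for every number `k ≥ 1` of alternatives (numbered `0, …, k - 1`) and every
vector of values `v`, a maximiser of `v` over the `k` alternatives. Ties are broken arbitrarily. -/
def IsArgmaxRule (sel : ℕ → (ℕ → ℝ) → ℕ) : Prop :=
  ∀ k : ℕ, 1 ≤ k → ∀ v : ℕ → ℝ, sel k v < k ∧ ∀ i < k, v i ≤ v (sel k v)

/-- The sample means `X̄_i(n_i)` for the sample sizes `n`, where `x i j` is the `j`-th observation
(counted from `0`) of alternative `i`. -/
noncomputable def sampleMeans (x : ℕ → ℕ → ℝ) (n : ℕ → ℕ) (i : ℕ) : ℝ :=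
  runningMean (x i) (n i)

/-- The sample sizes in the greedy procedure with `k` alternatives after `t` passes of the loop:
at first every alternative has one observation, and every pass takes one more observation from an
alternative with the largest current sample mean. -/
noncomputable def greedySizes (sel : ℕ → (ℕ → ℝ) → ℕ) (k : ℕ) (x : ℕ → ℕ → ℝ) : ℕ → ℕ → ℕ
  | 0 => fun _ => 1
  | t + 1 =>
    let n := greedySizes sel k x t
    let s := sel k (sampleMeans x n)
    Function.update n s (n s + 1)

/-- The alternative selected by the greedy procedure with `k` alternatives and budget `B`.
The first `k` observations are the initial ones, so the loop makes `B - k` passes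
(none if `B ≤ k`). -/
noncomputable def greedySelection (sel : ℕ → (ℕ → ℝ) → ℕ) (k B : ℕ) (x : ℕ → ℕ → ℝ) : ℕ :=
  sel k (sampleMeans x (greedySizes sel k x (B - k)))

/-- The probability of correct selection of the greedy procedure with `k` alternatives and
budget `B`: the probability that it selects alternative `0`, the best one. -/
noncomputable def greedyPCS {Ω : Type*} [MeasurableSpace Ω] (P : Measure Ω)
    (X : ℕ → ℕ → Ω → ℝ) (sel : ℕ → (ℕ → ℝ) → ℕ) (k B : ℕ) : ℝ :=
  P.real {ω | greedySelection sel k B (fun i j => X i j ω) = 0}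

/-- Consistency of a fixed-budget procedure with probability of correct selection `pcs k B` for
`k` alternatives and budget `B`: for every `α ∈ (0, 1)` there is `c > 0` such that
`liminf_{k → ∞} PCS ≥ α` for `B = c k` (rounded down to an integer). -/
def IsConsistent (pcs : ℕ → ℕ → ℝ) : Prop :=
  ∀ α ∈ Set.Ioo (0 : ℝ) 1, ∃ c : ℝ, 0 < c ∧
    α ≤ liminf (fun k : ℕ => pcs k ⌊c * (k : ℝ)⌋₊) atTop

/-! Write m for the common mean of the K inferior alternatives; the best one has index 0. Greedy
sampling pushes the largest sample mean down. Bringing all inferior alternatives to level m + x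
costs the sum of their first passage times to that level, which by the strong law is about K ·
C(x/σ), since the mean passage time is C(x/σ). Hence a budget of c per alternative only gets down to
a level m + t with t > 0, where C(·/σ) crosses c. If the running means of alternative 0 stay above m
+ t, the others drop below its minimum and it absorbs the remaining budget. If they fall below m +
t, it is abandoned and the budget ends before the others have come down to it. So PCS tends to P(min
> m + t) ≤ P(min > m) = 1/C(γ/σ) < 1, however large c is; if c ≤ 1 there is no such t and the limit
is 0. The two halves of the pathwise argument are `greedyChoice_eq_zero` and `greedyChoice_ne_zero`;
`tendsto_measureReal_of_sandwich` turns them into a limit.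

Both uses of C come from Spitzer's identity. With aₙ = P(Sₙ₊₁ > 0) and qₙ = P(S₁, …, Sₙ > 0), one
has (n + 1) qₙ₊₁ = ∑ aᵢ qₙ₋ᵢ, proved algebraically in `succ_nsmul_killedPow_succ`. Hence ∑ qₙ sⁿ =
exp (∑ aₙ sⁿ⁺¹ / (n + 1)). Letting s ↑ 1 gives ∑ qₙ = C for negative drift (the mean passage time)
and lim qₙ = 1/C for positive drift (the probability of never crossing). -/

/-! ### Spitzer's recursion in a commutative semiring. -/

section Factorization

variable {R : Type*} [CommSemiring R] (p q : R →+ R) (x : R)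

/-- The terms `g₀ = 1`, `gₙ₊₁ = p (gₙ x)`. With `x` a law on the line and `p` the restriction to
the positive half-line, `gₙ` is the law of the `n`-th partial sum of the random walk killed when it
leaves the positive half-line. -/
def killedPow : ℕ → R
  | 0 => 1
  | n + 1 => p (killedPow n * x)

/-- Decomposition at the first exit: the walk is still alive after `n + 1` steps, or it left at step
`j + 1`, with law `q (gⱼ x)`, and then made the `i` remaining steps freely. -/
theorem pow_succ_eq_killedPow_add_sum (hpq : ∀ y, p y + q y = y) (n : ℕ) :
    x ^ (n + 1) = killedPow p x (n + 1) +
      ∑ ij ∈ Finset.HasAntidiagonal.antidiagonal n, x ^ ij.1 * q (killedPow p x ij.2 * x) := by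
  induction n with
  | zero => simp [killedPow, hpq]
  | succ n ih =>
    rw [pow_succ, ih, add_mul, Finset.sum_mul, Finset.Nat.sum_antidiagonal_succ, pow_zero, one_mul,
      ← add_assoc, show killedPow p x (n + 1 + 1) = p (killedPow p x (n + 1) * x) from rfl, hpq]
    congr 1
    refine Finset.sum_congr rfl fun ij _ => ?_
    rw [pow_succ]
    ring

/-- Multiply the induction hypothesis by `x`, add the first-exit decomposition, and apply `p`: it
kills images of `q` and products of two such images, and fixes products of two images of `p`. -/
theorem succ_nsmul_killedPow_succ (hpq : ∀ y, p y + q y = y) (hpp : ∀ y, p (p y) = p y)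
    (hpq' : ∀ y, p (q y) = 0) (hmulp : ∀ y z, p (p y * p z) = p y * p z)
    (hmulq : ∀ y z, p (q y * q z) = 0) (n : ℕ) :
    (n + 1) • killedPow p x (n + 1) =
      ∑ ij ∈ Finset.HasAntidiagonal.antidiagonal n, p (x ^ (ij.1 + 1)) * killedPow p x ij.2 := by
  induction n with
  | zero => simp [killedPow]
  | succ n ih =>
    -- The sum of products of two `q`-images stays on the left because a semiring has no
    -- subtraction.
    have key : (n + 2) • (killedPow p x (n + 2) + q (killedPow p x (n + 1) * x)) +
        ∑ ij ∈ Finset.HasAntidiagonal.antidiagonal n, q (x ^ (ij.1 + 1)) * q (killedPow p x ij.2 * x) =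
        x ^ (n + 2) +
          ∑ ij ∈ Finset.HasAntidiagonal.antidiagonal n, p (x ^ (ij.1 + 1)) * killedPow p x (ij.2 + 1) := by
      have h1 : killedPow p x (n + 2) + q (killedPow p x (n + 1) * x) = killedPow p x (n + 1) * x :=
        hpq _
      have h2 : (n + 1) • (killedPow p x (n + 1) * x) =
          ∑ ij ∈ Finset.HasAntidiagonal.antidiagonal n, (p (x ^ (ij.1 + 1)) * killedPow p x (ij.2 + 1) +
            p (x ^ (ij.1 + 1)) * q (killedPow p x ij.2 * x)) := by
        rw [← smul_mul_assoc, ih, Finset.sum_mul]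
        refine Finset.sum_congr rfl fun ij _ => ?_
        rw [← mul_add, killedPow, hpq, mul_assoc]
      have h3 := pow_succ_eq_killedPow_add_sum p q x hpq (n + 1)
      rw [Finset.Nat.sum_antidiagonal_succ, pow_zero, one_mul, ← add_assoc, h1] at h3
      have h4 : ∑ ij ∈ Finset.HasAntidiagonal.antidiagonal n, x ^ (ij.1 + 1) * q (killedPow p x ij.2 * x) =
          ∑ ij ∈ Finset.HasAntidiagonal.antidiagonal n, p (x ^ (ij.1 + 1)) * q (killedPow p x ij.2 * x) +
          ∑ ij ∈ Finset.HasAntidiagonal.antidiagonal n, q (x ^ (ij.1 + 1)) * q (killedPow p x ij.2 * x) := by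
        rw [← Finset.sum_add_distrib]
        refine Finset.sum_congr rfl fun ij _ => ?_
        rw [← add_mul, hpq]
      rw [h1, h3, h4, succ_nsmul, h2, Finset.sum_add_distrib]
      abel
    have hg : ∀ m, p (killedPow p x (m + 1)) = killedPow p x (m + 1) := fun m => hpp _
    have hs1 : ∑ ij ∈ Finset.HasAntidiagonal.antidiagonal n, p (q (x ^ (ij.1 + 1)) * q (killedPow p x ij.2 * x)) =
        0 := Finset.sum_eq_zero fun ij _ => hmulq _ _
    have hs2 : ∑ ij ∈ Finset.HasAntidiagonal.antidiagonal n, p (p (x ^ (ij.1 + 1)) * killedPow p x (ij.2 + 1)) =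
        ∑ ij ∈ Finset.HasAntidiagonal.antidiagonal n, p (x ^ (ij.1 + 1)) * killedPow p x (ij.2 + 1) :=
      Finset.sum_congr rfl fun ij _ => hmulp _ _
    have := congrArg p key
    rw [map_add, map_nsmul, map_add, hpq', add_zero, hg, map_sum, hs1, add_zero, map_add, map_sum,
      hs2] at this
    rw [Finset.Nat.sum_antidiagonal_succ', this]
    simp [killedPow]

end Factorization

/-! ### Finite measures under convolution, and the recursion for survival probabilities. -/

section Convolution

open scoped MeasureTheory

/-- Finite measures on the line form a commutative semiring under convolution. -/
noncomputable instance finiteMeasureConvSemiring : CommSemiring (FiniteMeasure ℝ) :=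
  { (inferInstance : AddCommMonoid (FiniteMeasure ℝ)) with
    mul := fun a b => ⟨(a : Measure ℝ) ∗ (b : Measure ℝ), inferInstance⟩
    one := ⟨Measure.dirac 0, inferInstance⟩
    left_distrib := fun a b c => Subtype.ext (Measure.conv_add _ _ _)
    right_distrib := fun a b c => Subtype.ext (Measure.add_conv _ _ _)
    zero_mul := fun a => Subtype.ext (Measure.zero_conv _)
    mul_zero := fun a => Subtype.ext (Measure.conv_zero _)
    mul_assoc := fun a b c => Subtype.ext (Measure.conv_assoc _ _ _)
    one_mul := fun a => Subtype.ext (Measure.dirac_zero_conv _)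
    mul_one := fun a => Subtype.ext (Measure.conv_dirac_zero _)
    mul_comm := fun a b => Subtype.ext (Measure.conv_comm _ _) }

theorem coe_mul_finiteMeasure (a b : FiniteMeasure ℝ) :
    ((a * b : FiniteMeasure ℝ) : Measure ℝ) = (a : Measure ℝ) ∗ (b : Measure ℝ) := rfl

theorem mass_mul_finiteMeasure (a b : FiniteMeasure ℝ) : (a * b).mass = a.mass * b.mass := by
  rw [← ENNReal.coe_inj, ENNReal.coe_mul, FiniteMeasure.ennreal_mass, FiniteMeasure.ennreal_mass,
    FiniteMeasure.ennreal_mass, coe_mul_finiteMeasure, Measure.conv,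
    Measure.map_apply (by fun_prop) MeasurableSet.univ, Set.preimage_univ, ← Set.univ_prod_univ,
    Measure.prod_prod]

/-- The total mass of finite measures, as an additive map. -/
noncomputable def massAddHom : FiniteMeasure ℝ →+ ℝ where
  toFun a := a.mass
  map_zero' := by simp
  map_add' a b := by
    rw [← NNReal.coe_add, NNReal.coe_inj, ← ENNReal.coe_inj, ENNReal.coe_add,
      FiniteMeasure.ennreal_mass, FiniteMeasure.ennreal_mass, FiniteMeasure.ennreal_mass,
      FiniteMeasure.toMeasure_add, Measure.add_apply]

theorem massAddHom_mul (a b : FiniteMeasure ℝ) :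
    massAddHom (a * b) = massAddHom a * massAddHom b := by
  change ((a * b).mass : ℝ) = a.mass * b.mass
  rw [mass_mul_finiteMeasure, NNReal.coe_mul]

/-- Restriction of finite measures to a measurable set, as an additive map. -/
noncomputable def restrictAddHom (s : Set ℝ) : FiniteMeasure ℝ →+ FiniteMeasure ℝ where
  toFun a := a.restrict s
  map_zero' := Subtype.ext (by simp)
  map_add' a b := Subtype.ext (by
    simp [FiniteMeasure.restrict_measure_eq, Measure.restrict_add])

/-- Used for both half-lines: each is closed under addition, which yields the multiplicative
hypotheses on the two restrictions. -/
theorem conv_restrict_compl {s t u : Set ℝ}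
    (hu : MeasurableSet u) (h : ∀ x ∈ s, ∀ y ∈ t, x + y ∈ u) (a b : Measure ℝ) [SFinite a]
    [SFinite b] : (a.restrict s ∗ b.restrict t) uᶜ = 0 := by
  rw [Measure.conv, Measure.prod_restrict, Measure.map_apply (by fun_prop) hu.compl,
    Measure.restrict_apply (measurable_add hu.compl)]
  convert measure_empty (μ := a.prod b)
  ext z
  simp only [Set.mem_inter_iff, Set.mem_preimage, Set.mem_compl_iff, Set.mem_prod,
    Set.mem_empty_iff_false, iff_false, not_and]
  exact fun h1 h2 h3 => h1 (h _ h2 _ h3)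

/-- The `n`-th partial sum law of the random walk with step law `ν`, killed when it leaves the
positive half-line. -/
noncomputable def killedLaw (ν : FiniteMeasure ℝ) (n : ℕ) : FiniteMeasure ℝ :=
  killedPow (restrictAddHom (Set.Ioi 0)) ν n

/-- The semiring identity for the restrictions to the positive and nonpositive half-lines, read
through total mass, which is additive and multiplicative. -/
theorem succ_mul_mass_killedLaw (ν : FiniteMeasure ℝ) (n : ℕ) :
    ((n : ℝ) + 1) * ((killedLaw ν (n + 1)).mass : ℝ) = ∑ ij ∈ Finset.HasAntidiagonal.antidiagonal n,
      ((ν ^ (ij.1 + 1) : FiniteMeasure ℝ) : Measure ℝ).real (Set.Ioi 0) *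
        ((killedLaw ν ij.2).mass : ℝ) := by
  have hI : MeasurableSet (Set.Ioi (0 : ℝ)) := measurableSet_Ioi
  have hJ : MeasurableSet (Set.Iic (0 : ℝ)) := measurableSet_Iic
  have key := succ_nsmul_killedPow_succ (restrictAddHom (Set.Ioi 0)) (restrictAddHom (Set.Iic 0)) ν
    (fun y => Subtype.ext (by
      have := Measure.restrict_add_restrict_compl (μ := (y : Measure ℝ)) hI
      rwa [Set.compl_Ioi] at this))
    (fun y => Subtype.ext (by
      change ((y : Measure ℝ).restrict _).restrict _ = (y : Measure ℝ).restrict _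
      rw [Measure.restrict_restrict hI, Set.inter_self]))
    (fun y => Subtype.ext (by
      change ((y : Measure ℝ).restrict _).restrict _ = 0
      rw [Measure.restrict_restrict hI, Set.Ioi_inter_Iic, Set.Ioc_self, Measure.restrict_empty]))
    (fun y z => Subtype.ext (by
      change ((y : Measure ℝ).restrict _ ∗ (z : Measure ℝ).restrict _).restrict _ =
        ((y : Measure ℝ).restrict _ ∗ (z : Measure ℝ).restrict _)
      refine Measure.restrict_eq_self_of_ae_mem ?_
      exact conv_restrict_compl hI (fun x hx y hy => add_pos (Set.mem_Ioi.1 hx) hy) _ _))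
    (fun y z => Subtype.ext (by
      change ((y : Measure ℝ).restrict _ ∗ (z : Measure ℝ).restrict _).restrict _ = 0
      refine Measure.restrict_eq_zero.2 ?_
      have := conv_restrict_compl hJ (fun x hx y hy => add_nonpos (Set.mem_Iic.1 hx) hy)
        (y : Measure ℝ) (z : Measure ℝ)
      rwa [Set.compl_Iic] at this)) n
  have h2 := congrArg massAddHom key
  rw [map_nsmul, map_sum, nsmul_eq_mul, Nat.cast_succ] at h2
  refine h2.trans (Finset.sum_congr rfl fun ij _ => ?_)
  rw [massAddHom_mul]
  congr 1
  change (((restrictAddHom (Set.Ioi 0)) (ν ^ (ij.1 + 1))).mass : ℝ) = _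
  rw [FiniteMeasure.mass, FiniteMeasure.coeFn_def]
  change (((ν ^ (ij.1 + 1) : FiniteMeasure ℝ) : Measure ℝ).restrict (Set.Ioi 0)).real Set.univ = _
  rw [measureReal_restrict_apply MeasurableSet.univ, Set.univ_inter]

end Convolution

/-! ### Generating functions and Abel limits. -/

section PowerSeries

theorem summable_mul_pow_of_abs_le {c : ℕ → ℝ} {M s : ℝ} (hc : ∀ n, |c n| ≤ M) (hs : |s| < 1) :
    Summable fun n => c n * s ^ n := by
  refine Summable.of_norm_bounded
    ((summable_geometric_of_lt_one (abs_nonneg s) hs).mul_left M) fun n => ?_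
  rw [Real.norm_eq_abs, abs_mul, abs_pow]
  gcongr
  exact hc n

/-- Termwise differentiation, dominated uniformly on a ball of radius `r` with `|s| < r < 1`. -/
theorem hasDerivAt_tsum_mul_pow {c : ℕ → ℝ} {M s : ℝ} (hc : ∀ n, |c n| ≤ M) (hs : |s| < 1) :
    HasDerivAt (fun t => ∑' n, c n * t ^ n) (∑' n : ℕ, ((n : ℝ) + 1) * c (n + 1) * s ^ n) s := by
  obtain ⟨r, hsr, hr⟩ := exists_between hs
  have hr0 : 0 < r := (abs_nonneg s).trans_lt hsr
  have hu : Summable fun n : ℕ => M * (n * r ^ (n - 1)) := by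
    refine Summable.mul_left M ?_
    rw [← summable_nat_add_iff 1]
    have h1 := summable_pow_mul_geometric_of_norm_lt_one 1
      (r := r) (by rwa [Real.norm_eq_abs, abs_of_pos hr0])
    have h0 := summable_geometric_of_lt_one hr0.le hr
    refine (h1.add h0).congr fun n => ?_
    simp only [pow_one, Nat.add_sub_cancel, Nat.cast_succ]
    ring
  have hd : ∀ n : ℕ, ∀ y ∈ Metric.ball (0 : ℝ) r,
      HasDerivAt (fun t => c n * t ^ n) (c n * (n * y ^ (n - 1))) y :=
    fun n y _ => (hasDerivAt_pow n y).const_mul _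
  have hb : ∀ n : ℕ, ∀ y ∈ Metric.ball (0 : ℝ) r, ‖c n * (n * y ^ (n - 1))‖ ≤
      M * (n * r ^ (n - 1)) := by
    intro n y hy
    rw [mem_ball_zero_iff, Real.norm_eq_abs] at hy
    rw [Real.norm_eq_abs, abs_mul, abs_mul, abs_pow, Nat.abs_cast]
    have := (abs_nonneg _).trans (hc n)
    gcongr
    exact hc n
  have hs' : s ∈ Metric.ball (0 : ℝ) r := by rwa [mem_ball_zero_iff, Real.norm_eq_abs]
  have key := hasDerivAt_tsum_of_isPreconnected hu Metric.isOpen_ball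
    (convex_ball (0 : ℝ) r).isPreconnected hd hb hs' (summable_mul_pow_of_abs_le hc hs) hs'
  refine key.congr_deriv ?_
  rw [(Summable.of_norm_bounded hu fun n => hb n s hs').tsum_eq_zero_add]
  simp only [CharP.cast_eq_zero, zero_mul, mul_zero, zero_add, Nat.cast_succ, Nat.add_sub_cancel]
  exact tsum_congr fun n => by ring

variable {q a : ℕ → ℝ}

/-- The shifted coefficients are those of the antiderivative of `∑ aₙ sⁿ`, indexed by the exponent.
-/
theorem abs_shift_div_le (ha : ∀ n, |a n| ≤ 1) (n : ℕ) :
    |(if n = 0 then 0 else a (n - 1) / n : ℝ)| ≤ 1 := by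
  rcases n with _ | n
  · simp
  · simp only [Nat.add_eq_zero_iff, one_ne_zero, and_false, if_false, Nat.add_sub_cancel]
    rw [abs_div, Nat.abs_cast]
    refine div_le_one_of_le₀ ((ha n).trans ?_) (Nat.cast_nonneg _)
    exact_mod_cast Nat.succ_pos n

theorem tsum_shift_div {s : ℝ} (ha : ∀ n, |a n| ≤ 1) (hs : |s| < 1) :
    ∑' n : ℕ, (if n = 0 then 0 else a (n - 1) / n : ℝ) * s ^ n =
      ∑' n : ℕ, a n / ((n : ℝ) + 1) * s ^ (n + 1) := by
  rw [(summable_mul_pow_of_abs_le (abs_shift_div_le ha) hs).tsum_eq_zero_add]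
  simp

/-- A sequence with `(n + 1) qₙ₊₁ = ∑ᵢ aᵢ qₙ₋ᵢ` has the generating function
`exp (∑ₙ aₙ sⁿ⁺¹ / (n + 1))`. -/
theorem tsum_mul_pow_eq_exp (hq : ∀ n, |q n| ≤ 1) (ha : ∀ n, |a n| ≤ 1) (h0 : q 0 = 1)
    (h : ∀ n : ℕ, ((n : ℝ) + 1) * q (n + 1) =
      ∑ ij ∈ Finset.HasAntidiagonal.antidiagonal n, a ij.1 * q ij.2)
    {s : ℝ} (hs : |s| < 1) :
    ∑' n, q n * s ^ n = Real.exp (∑' n : ℕ, a n / ((n : ℝ) + 1) * s ^ (n + 1)) := by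
  rw [← tsum_shift_div ha hs]
  set b : ℕ → ℝ := fun n => if n = 0 then 0 else a (n - 1) / n with hb
  have hb1 : ∀ n, |b n| ≤ 1 := abs_shift_div_le ha
  have hbn : ∀ n : ℕ, ((n : ℝ) + 1) * b (n + 1) = a n := fun n => by
    simp only [hb, Nat.add_eq_zero_iff, one_ne_zero, and_false, if_false, Nat.add_sub_cancel,
      Nat.cast_succ]
    field_simp
  -- The recursion says Q' = A Q, and B' = A for the series B of `b`; so Q exp(-B) has derivative 0
  -- and keeps its value 1 at 0.
  set F : ℝ → ℝ := fun t => (∑' n, q n * t ^ n) * Real.exp (-∑' n, b n * t ^ n) with hF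
  have hderiv : ∀ t ∈ Metric.ball (0 : ℝ) 1, HasDerivAt F 0 t := by
    intro t ht
    rw [mem_ball_zero_iff, Real.norm_eq_abs] at ht
    have h1 := hasDerivAt_tsum_mul_pow hq ht
    have h2 := hasDerivAt_tsum_mul_pow hb1 ht
    have h3 := h1.mul h2.neg.exp
    refine h3.congr_deriv ?_
    have h4 : ∑' n : ℕ, ((n : ℝ) + 1) * q (n + 1) * t ^ n =
        (∑' n, a n * t ^ n) * ∑' n, q n * t ^ n := by
      rw [tsum_mul_tsum_eq_tsum_sum_antidiagonal_of_summable_norm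
        (summable_mul_pow_of_abs_le ha ht).norm (summable_mul_pow_of_abs_le hq ht).norm]
      refine tsum_congr fun n => ?_
      rw [h, Finset.sum_mul]
      refine Finset.sum_congr rfl fun ij hij => ?_
      rw [← Finset.HasAntidiagonal.mem_antidiagonal.1 hij, pow_add]
      ring
    rw [h4]
    simp_rw [hbn]
    ring
  have hconst := Metric.isOpen_ball.is_const_of_deriv_eq_zero
    (convex_ball (0 : ℝ) 1).isPreconnected
    (fun t ht => (hderiv t ht).differentiableAt.differentiableWithinAt)
    (fun t ht => (hderiv t ht).deriv)
    (x := s) (y := 0) (by rwa [mem_ball_zero_iff, Real.norm_eq_abs])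
    (Metric.mem_ball_self one_pos)
  have hz : ∀ c : ℕ → ℝ, ∑' n, c n * (0 : ℝ) ^ n = c 0 := fun c => by
    rw [tsum_eq_single 0 fun n hn => by simp [hn]]
    simp
  have hF0 : F 0 = 1 := by simp only [hF, hz, h0]; simp [hb]
  rw [hF0] at hconst
  simp only [hF, Real.exp_neg] at hconst
  have := Real.exp_ne_zero (∑' n, b n * s ^ n)
  field_simp at hconst
  exact hconst

/-- Abel's limit theorem, after pulling out one factor `s`. -/
theorem tendsto_tsum_div_mul_pow (hsum : Summable fun n : ℕ => a n / ((n : ℝ) + 1)) :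
    Tendsto (fun s : ℝ => ∑' n : ℕ, a n / ((n : ℝ) + 1) * s ^ (n + 1)) (𝓝[<] 1)
      (𝓝 (∑' n : ℕ, a n / ((n : ℝ) + 1))) := by
  have h1 := Real.tendsto_tsum_powerSeries_nhdsWithin_lt hsum.hasSum.tendsto_sum_nat
  have h2 : Tendsto (fun s : ℝ => s) (𝓝[<] 1) (𝓝 1) := tendsto_nhdsWithin_of_tendsto_nhds tendsto_id
  have h3 := h2.mul h1
  rw [one_mul] at h3
  refine h3.congr fun s => ?_
  rw [← tsum_mul_left]
  exact tsum_congr fun n => by ring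

theorem eventually_abs_lt_one : ∀ᶠ s : ℝ in 𝓝[<] 1, 0 < s ∧ |s| < 1 := by
  filter_upwards [Ioo_mem_nhdsLT (show (0 : ℝ) < 1 by norm_num)] with s hs
  exact ⟨hs.1, by rw [abs_of_pos hs.1]; exact hs.2⟩

/-- Since the terms are nonnegative, the finite limit as s ↑ 1 bounds all partial sums; the series
therefore converges, and Abel's theorem identifies its sum. -/
theorem hasSum_of_convolution_recursion (hq0 : ∀ n, 0 ≤ q n) (hq : ∀ n, q n ≤ 1)
    (ha0 : ∀ n, 0 ≤ a n) (ha : ∀ n, a n ≤ 1) (h0 : q 0 = 1)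
    (h : ∀ n : ℕ, ((n : ℝ) + 1) * q (n + 1) =
      ∑ ij ∈ Finset.HasAntidiagonal.antidiagonal n, a ij.1 * q ij.2)
    (hsum : Summable fun n : ℕ => a n / ((n : ℝ) + 1)) :
    HasSum q (Real.exp (∑' n : ℕ, a n / ((n : ℝ) + 1))) := by
  have hq' : ∀ n, |q n| ≤ 1 := fun n => by rw [abs_of_nonneg (hq0 n)]; exact hq n
  have ha' : ∀ n, |a n| ≤ 1 := fun n => by rw [abs_of_nonneg (ha0 n)]; exact ha n
  have hlim : Tendsto (fun s : ℝ => ∑' n, q n * s ^ n) (𝓝[<] 1)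
      (𝓝 (Real.exp (∑' n : ℕ, a n / ((n : ℝ) + 1)))) := by
    refine ((Real.continuous_exp.tendsto _).comp (tendsto_tsum_div_mul_pow hsum)).congr' ?_
    filter_upwards [eventually_abs_lt_one] with s hs
    exact (tsum_mul_pow_eq_exp hq' ha' h0 h hs.2).symm
  have hpartial : ∀ n, ∑ i ∈ Finset.range n, q i ≤
      Real.exp (∑' n : ℕ, a n / ((n : ℝ) + 1)) := by
    intro n
    have hc : Tendsto (fun s : ℝ => ∑ i ∈ Finset.range n, q i * s ^ i) (𝓝[<] 1)
        (𝓝 (∑ i ∈ Finset.range n, q i)) := by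
      have : Continuous fun s : ℝ => ∑ i ∈ Finset.range n, q i * s ^ i := by fun_prop
      have h1 := this.tendsto 1
      simp only [one_pow, mul_one] at h1
      exact tendsto_nhdsWithin_of_tendsto_nhds h1
    refine le_of_tendsto_of_tendsto hc hlim ?_
    filter_upwards [eventually_abs_lt_one] with s hs
    exact (summable_mul_pow_of_abs_le hq' hs.2).sum_le_tsum _
      fun i _ => mul_nonneg (hq0 i) (pow_nonneg hs.1.le i)
  have hs := summable_of_sum_range_le hq0 hpartial
  have := tendsto_nhds_unique hlim
    (Real.tendsto_tsum_powerSeries_nhdsWithin_lt hs.hasSum.tendsto_sum_nat)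
  rw [this]
  exact hs.hasSum

/-- By Abel, (1 - s) ∑ qₙ sⁿ tends to lim qₙ. As -log (1 - s) = ∑ sⁿ⁺¹ / (n + 1), the factor 1 - s
replaces aₙ in the exponent by -(1 - aₙ). -/
theorem limit_of_convolution_recursion {p : ℝ} (hq0 : ∀ n, 0 ≤ q n) (hq : ∀ n, q n ≤ 1)
    (ha0 : ∀ n, 0 ≤ a n) (ha : ∀ n, a n ≤ 1) (h0 : q 0 = 1)
    (h : ∀ n : ℕ, ((n : ℝ) + 1) * q (n + 1) =
      ∑ ij ∈ Finset.HasAntidiagonal.antidiagonal n, a ij.1 * q ij.2)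
    (hsum : Summable fun n : ℕ => (1 - a n) / ((n : ℝ) + 1)) (hp : Tendsto q atTop (𝓝 p)) :
    p = (Real.exp (∑' n : ℕ, (1 - a n) / ((n : ℝ) + 1)))⁻¹ := by
  have hq' : ∀ n, |q n| ≤ 1 := fun n => by rw [abs_of_nonneg (hq0 n)]; exact hq n
  have ha' : ∀ n, |a n| ≤ 1 := fun n => by rw [abs_of_nonneg (ha0 n)]; exact ha n
  -- The increments of `q`, with `d 0 = q 0`: their partial sums are `q`, and their generating
  -- function is (1 - s) ∑ qₙ sⁿ.
  set d : ℕ → ℝ := fun n => q n - if n = 0 then 0 else q (n - 1) with hd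
  have hdsum : ∀ n, ∑ i ∈ Finset.range (n + 1), d i = q n := by
    intro n
    induction n with
    | zero => simp [hd]
    | succ n ih => rw [Finset.sum_range_succ, ih]; simp [hd]
  have hdp : Tendsto (fun n => ∑ i ∈ Finset.range n, d i) atTop (𝓝 p) := by
    rw [← tendsto_add_atTop_iff_nat 1]
    exact hp.congr fun n => (hdsum n).symm
  have hlim := Real.tendsto_tsum_powerSeries_nhdsWithin_lt hdp
  have hlim' := ((Real.continuous_exp.tendsto _).comp (tendsto_tsum_div_mul_pow hsum)).inv₀
    (Real.exp_ne_zero _)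
  refine tendsto_nhds_unique (hlim.congr' ?_) hlim'
  filter_upwards [eventually_abs_lt_one] with s hs
  have hQ := summable_mul_pow_of_abs_le hq' hs.2
  have hshift : HasSum (fun n : ℕ => (if n = 0 then 0 else q (n - 1)) * s ^ n)
      (s * ∑' n, q n * s ^ n) := by
    rw [← hasSum_nat_add_iff' 1]
    simp only [Nat.add_eq_zero_iff, one_ne_zero, and_false, if_false, Nat.add_sub_cancel,
      Finset.range_one, Finset.sum_singleton, if_true, zero_mul, sub_zero]
    rw [show (fun n => q n * s ^ (n + 1)) = fun n => s * (q n * s ^ n) from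
      funext fun n => by ring]
    exact hQ.hasSum.mul_left s
  have h1 : ∑' n, d n * s ^ n = (1 - s) * ∑' n, q n * s ^ n := by
    have := (hQ.hasSum.sub hshift).tsum_eq
    rw [one_sub_mul, ← this]
    exact tsum_congr fun n => sub_mul _ _ _
  have hlog := Real.hasSum_pow_div_log_of_abs_lt_one hs.2
  have hA : Summable fun n : ℕ => a n / ((n : ℝ) + 1) * s ^ (n + 1) := by
    have := summable_mul_pow_of_abs_le (abs_shift_div_le ha') hs.2
    rw [← summable_nat_add_iff 1] at this
    simpa using this
  have h2 : ∑' n : ℕ, (1 - a n) / ((n : ℝ) + 1) * s ^ (n + 1) =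
      -Real.log (1 - s) - ∑' n : ℕ, a n / ((n : ℝ) + 1) * s ^ (n + 1) := by
    rw [← (hlog.sub hA.hasSum).tsum_eq]
    exact tsum_congr fun n => by ring
  have hs1 : 0 < 1 - s := by linarith [(abs_lt.1 hs.2).2]
  rw [h1, tsum_mul_pow_eq_exp hq' ha' h0 h hs.2, Function.comp_apply, h2, ← Real.exp_neg, neg_sub,
    sub_neg_eq_add, Real.exp_add, Real.exp_log hs1, mul_comm]

end PowerSeries

/-! ### Gaussian tails and the function C. -/

section Gaussian

theorem stdNormalCDF_eq (x : ℝ) : stdNormalCDF x = (gaussianReal 0 1).real (Set.Iic x) :=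
  cdf_eq_real _ _

theorem stdNormalCDF_nonneg (x : ℝ) : 0 ≤ stdNormalCDF x := cdf_nonneg _ _

theorem stdNormalCDF_strictMono : StrictMono stdNormalCDF := by
  intro x y hxy
  rw [stdNormalCDF_eq, stdNormalCDF_eq, ← Set.Iic_union_Ioc_eq_Iic hxy.le,
    measureReal_union (Set.Iic_disjoint_Ioc le_rfl) measurableSet_Ioc]
  refine lt_add_of_pos_right _ (ENNReal.toReal_pos (fun h => ?_) (measure_ne_top _ _))
  have h1 := gaussianReal_absolutelyContinuous' 0 (one_ne_zero (α := ℝ≥0)) h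
  rw [Real.volume_Ioc, ENNReal.ofReal_eq_zero] at h1
  linarith

theorem stdNormalCDF_pos (x : ℝ) : 0 < stdNormalCDF x :=
  (stdNormalCDF_nonneg (x - 1)).trans_lt (stdNormalCDF_strictMono (by linarith))

/-- Chernoff bound with the optimal parameter `-y`. -/
theorem stdNormalCDF_neg_le_exp {y : ℝ} (hy : 0 ≤ y) :
    stdNormalCDF (-y) ≤ Real.exp (-(y ^ 2 / 2)) := by
  rw [stdNormalCDF_eq]
  have h := measure_le_le_exp_mul_mgf (μ := gaussianReal 0 1) (X := id) (t := -y) (-y) (by linarith)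
    (integrable_exp_mul_gaussianReal _)
  refine h.trans (le_of_eq ?_)
  rw [mgf_id_gaussianReal, ← Real.exp_add]
  simp only [NNReal.coe_one]
  ring_nf

theorem gaussianReal_real_Iic_zero (m : ℝ) {s : ℝ} (hs : 0 < s) :
    (gaussianReal m (s ^ 2).toNNReal).real (Set.Iic 0) = stdNormalCDF (-(m / s)) := by
  have h : gaussianReal m (s ^ 2).toNNReal = (gaussianReal 0 1).map (fun x => s * x + m) := by
    have h1 := gaussianReal_map_const_mul (μ := 0) (v := 1) s
    have h2 := gaussianReal_map_add_const (μ := s * 0) (v := NNReal.mk (s ^ 2) (sq_nonneg s) * 1) m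
    rw [← h1, Measure.map_map (by fun_prop) (by fun_prop)] at h2
    rw [show (s ^ 2).toNNReal = NNReal.mk (s ^ 2) (sq_nonneg s) * 1 by
      rw [mul_one, Real.toNNReal_of_nonneg (sq_nonneg s)]]
    rw [mul_zero, zero_add] at h2
    exact h2.symm
  rw [h, map_measureReal_apply (by fun_prop) measurableSet_Iic, stdNormalCDF_eq]
  congr 1
  ext z
  simp only [Set.mem_preimage, Set.mem_Iic]
  rw [← neg_div, le_div_iff₀ hs]
  constructor <;> intro <;> linarith

theorem gaussianReal_real_Ioi_zero (m : ℝ) {s : ℝ} (hs : 0 < s) :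
    (gaussianReal m (s ^ 2).toNNReal).real (Set.Ioi 0) = stdNormalCDF (m / s) := by
  have hv : (s ^ 2).toNNReal ≠ 0 := by
    rw [Ne, Real.toNNReal_eq_zero, not_le]
    positivity
  have := nullSingletonClass_gaussianReal (μ := m) hv
  have h := gaussianReal_real_Iic_zero (-m) hs
  rw [neg_div, neg_neg, ← gaussianReal_map_neg,
    map_measureReal_apply (by fun_prop) measurableSet_Iic] at h
  rw [← h]
  have h2 : (fun x : ℝ => -x) ⁻¹' Set.Iic 0 = Set.Ici 0 := by ext; simp
  rw [h2]
  exact measureReal_congr Ioi_ae_eq_Ici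

/-- The normal law with mean `m` and variance `s²`, as a finite measure. -/
noncomputable def gaussianFM (m s : ℝ) : FiniteMeasure ℝ :=
  ⟨gaussianReal m (s ^ 2).toNNReal, inferInstance⟩

/-- The variance is written as a square so that the half-line formulas apply directly. -/
theorem coe_gaussianFM_pow_succ (m s : ℝ) (n : ℕ) :
    ((gaussianFM m s ^ (n + 1) : FiniteMeasure ℝ) : Measure ℝ) =
      gaussianReal ((n + 1) * m) ((Real.sqrt (n + 1) * s) ^ 2).toNNReal := by
  induction n with
  | zero =>
    rw [zero_add, pow_one]
    change gaussianReal m (s ^ 2).toNNReal = _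
    simp
  | succ n ih =>
    rw [pow_succ, coe_mul_finiteMeasure, ih]
    change _ ∗ gaussianReal m (s ^ 2).toNNReal = _
    rw [gaussianReal_conv_gaussianReal, ← Real.toNNReal_add (sq_nonneg _) (sq_nonneg _)]
    congr 2
    · push_cast; ring
    · rw [mul_pow, mul_pow, Real.sq_sqrt (by positivity), Real.sq_sqrt (by positivity)]
      push_cast; ring

theorem succ_mul_div_sqrt (m s : ℝ) (n : ℕ) :
    ((n : ℝ) + 1) * m / (Real.sqrt (n + 1) * s) = Real.sqrt (n + 1) * (m / s) := by
  rw [mul_div_mul_comm, Real.div_sqrt]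

theorem gaussianFM_pow_succ_real_Ioi (m : ℝ) {s : ℝ} (hs : 0 < s) (n : ℕ) :
    ((gaussianFM m s ^ (n + 1) : FiniteMeasure ℝ) : Measure ℝ).real (Set.Ioi 0) =
      stdNormalCDF (Real.sqrt (n + 1) * (m / s)) := by
  rw [coe_gaussianFM_pow_succ, gaussianReal_real_Ioi_zero _ (by positivity), succ_mul_div_sqrt]

theorem one_sub_gaussianFM_pow_succ_real_Ioi (m : ℝ) {s : ℝ} (hs : 0 < s) (n : ℕ) :
    1 - ((gaussianFM m s ^ (n + 1) : FiniteMeasure ℝ) : Measure ℝ).real (Set.Ioi 0) =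
      stdNormalCDF (-(Real.sqrt (n + 1) * (m / s))) := by
  rw [coe_gaussianFM_pow_succ, ← succ_mul_div_sqrt, ← gaussianReal_real_Iic_zero _ (by positivity),
    ← probReal_compl_eq_one_sub measurableSet_Ioi, Set.compl_Ioi]

/-- The Chernoff bound gives a geometric majorant of ratio exp(-x²/2). -/
theorem summable_boundaryC {x : ℝ} (hx : 0 < x) :
    Summable fun n : ℕ => 1 / ((n : ℝ) + 1) * stdNormalCDF (-(Real.sqrt ((n : ℝ) + 1) * x)) := by
  have hr : Real.exp (-(x ^ 2 / 2)) < 1 := by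
    rw [← Real.exp_zero, Real.exp_lt_exp]
    nlinarith [sq_pos_of_pos hx]
  have hg := (summable_nat_add_iff 1).2 (summable_geometric_of_lt_one (Real.exp_pos _).le hr)
  refine Summable.of_nonneg_of_le
    (fun n => mul_nonneg (by positivity) (stdNormalCDF_nonneg _)) (fun n => ?_) hg
  have h1 := stdNormalCDF_neg_le_exp (y := Real.sqrt ((n : ℝ) + 1) * x) (by positivity)
  rw [mul_pow, Real.sq_sqrt (by positivity)] at h1
  rw [← Real.exp_nat_mul]
  have h2 : 1 / ((n : ℝ) + 1) ≤ 1 := by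
    rw [div_le_one (by positivity)]
    linarith [Nat.cast_nonneg (α := ℝ) n]
  calc _ ≤ 1 * Real.exp (-((↑n + 1) * x ^ 2 / 2)) :=
        mul_le_mul h2 h1 (stdNormalCDF_nonneg _) zero_le_one
    _ = _ := by rw [one_mul]; congr 1; push_cast; ring

theorem one_lt_boundaryC {x : ℝ} (hx : 0 < x) : 1 < boundaryC x := by
  rw [boundaryC, Real.one_lt_exp_iff]
  exact (summable_boundaryC hx).tsum_pos (fun n => mul_nonneg (by positivity) (stdNormalCDF_nonneg _))
    0 (mul_pos (by positivity) (stdNormalCDF_pos _))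

theorem boundaryC_strictAntiOn : StrictAntiOn boundaryC (Set.Ioi 0) := by
  intro x hx y hy hxy
  rw [boundaryC, boundaryC, Real.exp_lt_exp]
  have hlt : ∀ n : ℕ, 1 / ((n : ℝ) + 1) * stdNormalCDF (-(Real.sqrt ((n : ℝ) + 1) * y)) <
      1 / ((n : ℝ) + 1) * stdNormalCDF (-(Real.sqrt ((n : ℝ) + 1) * x)) := by
    intro n
    refine mul_lt_mul_of_pos_left (stdNormalCDF_strictMono ?_) (by positivity)
    have : 0 < Real.sqrt ((n : ℝ) + 1) := by positivity
    nlinarith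
  exact Summable.tsum_lt_tsum (i := 0) (fun n => (hlt n).le) (hlt 0) (summable_boundaryC hy)
    (summable_boundaryC hx)

/-- For y ≤ 1/√(N + 1) the first N terms keep a factor at least Φ(-1), and the harmonic series
diverges. -/
theorem exists_lt_boundaryC (c : ℝ) : ∃ x > 0, ∀ y, 0 < y → y ≤ x → c < boundaryC y := by
  have hδ := stdNormalCDF_pos (-1)
  have hT := Real.tendsto_exp_atTop.comp
    (Real.tendsto_sum_range_one_div_nat_succ_atTop.atTop_mul_const hδ)
  obtain ⟨N, hN⟩ := (hT.eventually_gt_atTop c).exists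
  have hs : 0 < Real.sqrt ((N : ℝ) + 1) := by positivity
  refine ⟨1 / Real.sqrt (N + 1), by positivity, fun y hy hyx => hN.trans_le ?_⟩
  rw [Function.comp_apply, boundaryC, Real.exp_le_exp, Finset.sum_mul]
  refine le_trans (Finset.sum_le_sum fun n hn => ?_) ((summable_boundaryC hy).sum_le_tsum
    (Finset.range N) fun n _ => mul_nonneg (by positivity) (stdNormalCDF_nonneg _))
  refine mul_le_mul_of_nonneg_left (stdNormalCDF_strictMono.monotone ?_) (by positivity)
  have h1 : Real.sqrt ((n : ℝ) + 1) ≤ Real.sqrt ((N : ℝ) + 1) := by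
    gcongr
    exact (Finset.mem_range.1 hn).le
  have h2 : Real.sqrt ((N : ℝ) + 1) * y ≤ 1 := by
    rw [le_div_iff₀ hs] at hyx
    linarith
  nlinarith

end Gaussian

/-! ### Survival probabilities of a random walk. -/

section RandomWalk

variable {Ω : Type*} [MeasurableSpace Ω] {P : Measure Ω} [IsProbabilityMeasure P]
  {Y : ℕ → Ω → ℝ}

/-- The event that the first `n` partial sums of a sequence are positive. -/
def sumsPos (n : ℕ) : Set (ℕ → ℝ) :=
  {z | ∀ m, 1 ≤ m → m ≤ n → 0 < ∑ j ∈ Finset.range m, z j}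

theorem measurableSet_sumsPos (n : ℕ) : MeasurableSet (sumsPos n) := by
  simp only [sumsPos, Set.ofPred_forall]
  refine MeasurableSet.iInter fun m => MeasurableSet.iInter fun _ => MeasurableSet.iInter fun _ => ?_
  exact measurableSet_lt measurable_const (by fun_prop)

theorem sumsPos_congr {n : ℕ} {z w : ℕ → ℝ} (h : ∀ j < n, z j = w j) :
    z ∈ sumsPos n ↔ w ∈ sumsPos n := by
  refine forall_congr' fun m => forall_congr' fun _ => forall_congr' fun hm => ?_
  rw [Finset.sum_congr rfl fun j hj => h j ((Finset.mem_range.1 hj).trans_le hm)]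

theorem sumsPos_succ (n : ℕ) :
    sumsPos (n + 1) = sumsPos n ∩ {z | 0 < ∑ j ∈ Finset.range (n + 1), z j} := by
  ext z
  constructor
  · exact fun h => ⟨fun m h1 h2 => h m h1 (by omega), h (n + 1) (by omega) le_rfl⟩
  · rintro ⟨h1, h2⟩ m hm hmn
    rcases Nat.lt_or_ge n m with h | h
    · obtain rfl : m = n + 1 := by omega
      exact h2
    · exact h1 m hm h

/-- The event and the sum up to `n` depend only on the first `n` variables, so the independent next
step convolves with `ν`; the new constraint restricts to the positive half-line. -/
theorem map_restrict_sumsPos (hY : ∀ j, Measurable (Y j)) (hind : iIndepFun Y P)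
    (ν : FiniteMeasure ℝ) (hν : ∀ j, P.map (Y j) = ν) (n : ℕ) :
    (P.restrict {ω | (fun j => Y j ω) ∈ sumsPos n}).map (fun ω => ∑ j ∈ Finset.range n, Y j ω) =
      (killedLaw ν n : Measure ℝ) := by
  have hYm : Measurable fun ω j => Y j ω := measurable_pi_lambda _ hY
  have hA : ∀ n, MeasurableSet {ω | (fun j => Y j ω) ∈ sumsPos n} := fun n =>
    hYm (measurableSet_sumsPos n)
  induction n with
  | zero =>
    have h0 : {ω | (fun j => Y j ω) ∈ sumsPos 0} = Set.univ := by
      ext ω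
      simp only [sumsPos, Set.mem_ofPred_eq, Set.mem_univ, iff_true]
      omega
    rw [h0, Measure.restrict_univ]
    simp only [Finset.range_zero, Finset.sum_empty, Measure.map_const, measure_univ, one_smul]
    rfl
  | succ n ih =>
    set f : Ω → (Finset.range n → ℝ) := fun ω i => Y i ω with hf
    have hfm : Measurable f := measurable_pi_lambda _ fun i => hY i
    -- The padding value 0 is irrelevant: only coordinates below `n` enter.
    set ext : (Finset.range n → ℝ) → ℕ → ℝ :=
      fun u j => if h : j ∈ Finset.range n then u ⟨j, h⟩ else 0 with hext
    have hextm : Measurable ext := by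
      refine measurable_pi_lambda _ fun j => ?_
      by_cases h : j ∈ Finset.range n
      · simp only [hext, h, dif_pos]; fun_prop
      · simp only [hext, h, dif_neg, not_false_eq_true]; fun_prop
    have hef : ∀ ω, ∀ j < n, ext (f ω) j = Y j ω := fun ω j hj => by
      simp [hext, hf, hj]
    set A' : Set (Finset.range n → ℝ) := ext ⁻¹' sumsPos n with hA'
    have hA'm : MeasurableSet A' := hextm (measurableSet_sumsPos n)
    set s : (Finset.range n → ℝ) → ℝ := fun u => ∑ j ∈ Finset.range n, ext u j with hs
    have hsm : Measurable s := by fun_prop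
    have hsf : ∀ ω, s (f ω) = ∑ j ∈ Finset.range n, Y j ω := fun ω =>
      Finset.sum_congr rfl fun j hj => hef ω j (Finset.mem_range.1 hj)
    have hAf : {ω | (fun j => Y j ω) ∈ sumsPos n} = f ⁻¹' A' := by
      ext ω
      exact (sumsPos_congr (hef ω)).symm
    have hindep : IndepFun f (Y n) P := by
      have h1 := hind.indepFun_finset (Finset.range n) {n} (by simp) hY
      exact h1.comp measurable_id
        (measurable_pi_apply (⟨n, Finset.mem_singleton_self n⟩ : ({n} : Finset ℕ)))
    have hjoint : P.map (fun ω => (f ω, Y n ω)) = (P.map f).prod ν := by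
      rw [(indepFun_iff_map_prod_eq_prod_map_map hfm.aemeasurable (hY n).aemeasurable).1 hindep, hν]
    have hg : ((P.map f).restrict A').map s = (killedLaw ν n : Measure ℝ) := by
      rw [← ih, hAf, Measure.restrict_map hfm hA'm, Measure.map_map hsm hfm]
      congr 1
      ext ω
      exact hsf ω
    have hstep : (P.restrict {ω | (fun j => Y j ω) ∈ sumsPos n}).map
        (fun ω => ∑ j ∈ Finset.range (n + 1), Y j ω) = (killedLaw ν n : Measure ℝ) ∗ ν := by
      have hprod : (((P.map f).restrict A').map s).prod (ν : Measure ℝ) =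
          (((P.map f).prod (ν : Measure ℝ)).restrict (A' ×ˢ Set.univ)).map (Prod.map s id) := by
        rw [← Measure.prod_restrict, Measure.restrict_univ,
          ← Measure.map_prod_map _ _ hsm measurable_id, Measure.map_id]
      rw [Measure.conv, ← hg, hprod, Measure.map_map (by fun_prop) (by fun_prop), ← hjoint,
        Measure.restrict_map (by fun_prop) (hA'm.prod MeasurableSet.univ),
        Measure.map_map (by fun_prop) (by fun_prop), hAf]
      have : (fun ω => (f ω, Y n ω)) ⁻¹' (A' ×ˢ Set.univ) = f ⁻¹' A' := by ext; simp
      rw [this]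
      congr 1
      funext ω
      simp only [Function.comp_apply, Prod.map_apply, id_eq, hsf]
      rw [Finset.sum_range_succ]
    change _ = ((killedLaw ν n : Measure ℝ) ∗ ν).restrict (Set.Ioi 0)
    rw [← hstep, Measure.restrict_map (by fun_prop) measurableSet_Ioi,
      Measure.restrict_restrict (by measurability)]
    congr 2
    rw [Set.inter_comm]
    exact congrArg (fun s => (fun ω j => Y j ω) ⁻¹' s) (sumsPos_succ n)

theorem real_sumsPos (hY : ∀ j, Measurable (Y j)) (hind : iIndepFun Y P)
    (ν : FiniteMeasure ℝ) (hν : ∀ j, P.map (Y j) = ν) (n : ℕ) :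
    P.real {ω | (fun j => Y j ω) ∈ sumsPos n} = (killedLaw ν n).mass := by
  change _ = (killedLaw ν n : Measure ℝ).real Set.univ
  rw [← map_restrict_sumsPos hY hind ν hν n, map_measureReal_apply (by fun_prop) MeasurableSet.univ,
    Set.preimage_univ, measureReal_restrict_apply MeasurableSet.univ, Set.univ_inter]

theorem succ_mul_real_sumsPos (hY : ∀ j, Measurable (Y j)) (hind : iIndepFun Y P)
    (ν : FiniteMeasure ℝ) (hν : ∀ j, P.map (Y j) = ν) (n : ℕ) :
    ((n : ℝ) + 1) * P.real {ω | (fun j => Y j ω) ∈ sumsPos (n + 1)} =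
      ∑ ij ∈ Finset.HasAntidiagonal.antidiagonal n,
        ((ν ^ (ij.1 + 1) : FiniteMeasure ℝ) : Measure ℝ).real (Set.Ioi 0) *
          P.real {ω | (fun j => Y j ω) ∈ sumsPos ij.2} := by
  simp only [real_sumsPos hY hind ν hν]
  exact succ_mul_mass_killedLaw ν n

theorem real_sumsPos_zero : P.real {ω | (fun j => Y j ω) ∈ sumsPos 0} = 1 := by
  have h0 : {ω | (fun j => Y j ω) ∈ sumsPos 0} = Set.univ := by
    ext ω
    simp only [sumsPos, Set.mem_ofPred_eq, Set.mem_univ, iff_true]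
    omega
  rw [h0, probReal_univ]

/-- For a Gaussian random walk with drift `-x < 0`, the probabilities that the first `n` partial
sums are positive add up to `C (x / σ)`. -/
theorem hasSum_real_sumsPos (hY : ∀ j, Measurable (Y j)) (hind : iIndepFun Y P) {x σ : ℝ}
    (hx : 0 < x) (hσ : 0 < σ) (hlaw : ∀ j, P.map (Y j) = gaussianReal (-x) (σ ^ 2).toNNReal) :
    HasSum (fun n => P.real {ω | (fun j => Y j ω) ∈ sumsPos n}) (boundaryC (x / σ)) := by
  have ha : ∀ n : ℕ, ((gaussianFM (-x) σ ^ (n + 1) : FiniteMeasure ℝ) : Measure ℝ).real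
      (Set.Ioi 0) = stdNormalCDF (-(Real.sqrt (n + 1) * (x / σ))) := fun n => by
    rw [gaussianFM_pow_succ_real_Ioi _ hσ, neg_div, mul_neg]
  have hrec := succ_mul_real_sumsPos hY hind (gaussianFM (-x) σ) hlaw
  simp only [ha] at hrec
  have hs := summable_boundaryC (div_pos hx hσ)
  have := hasSum_of_convolution_recursion
    (q := fun n => P.real {ω | (fun j => Y j ω) ∈ sumsPos n})
    (a := fun n : ℕ => stdNormalCDF (-(Real.sqrt (n + 1) * (x / σ))))
    (fun n => measureReal_nonneg) (fun n => measureReal_le_one) (fun n => stdNormalCDF_nonneg _)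
    (fun n => cdf_le_one _ _) real_sumsPos_zero hrec (hs.congr fun n => by ring)
  rw [boundaryC]
  convert this using 4
  ring

/-- For a Gaussian random walk with drift `x > 0`, all partial sums are positive with probability
`C (x / σ)⁻¹`. -/
theorem real_forall_sum_pos (hY : ∀ j, Measurable (Y j)) (hind : iIndepFun Y P) {x σ : ℝ}
    (hx : 0 < x) (hσ : 0 < σ) (hlaw : ∀ j, P.map (Y j) = gaussianReal x (σ ^ 2).toNNReal) :
    P.real {ω | ∀ n, 1 ≤ n → 0 < ∑ j ∈ Finset.range n, Y j ω} = (boundaryC (x / σ))⁻¹ := by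
  have hYm : Measurable fun ω j => Y j ω := measurable_pi_lambda _ hY
  obtain ⟨a, ha⟩ : ∃ a : ℕ → ℝ, ∀ n : ℕ, ((gaussianFM x σ ^ (n + 1) : FiniteMeasure ℝ) :
      Measure ℝ).real (Set.Ioi 0) = a n := ⟨_, fun n => rfl⟩
  have hrec := succ_mul_real_sumsPos hY hind (gaussianFM x σ) hlaw
  have ha0 : ∀ n, 0 ≤ a n := fun n => ha n ▸ measureReal_nonneg
  have ha1 : ∀ n : ℕ, 1 - a n = stdNormalCDF (-(Real.sqrt (n + 1) * (x / σ))) := fun n => by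
    rw [← ha, one_sub_gaussianFM_pow_succ_real_Ioi x hσ]
  have ha2 : ∀ n, a n ≤ 1 := fun n => by
    linarith [ha1 n, stdNormalCDF_nonneg (-(Real.sqrt (n + 1) * (x / σ)))]
  simp only [ha] at hrec
  have hs := summable_boundaryC (div_pos hx hσ)
  have hInter : {ω | ∀ n, 1 ≤ n → 0 < ∑ j ∈ Finset.range n, Y j ω} =
      ⋂ n, {ω | (fun j => Y j ω) ∈ sumsPos n} := by
    ext ω
    simp only [Set.mem_ofPred_eq, Set.mem_iInter, sumsPos]
    exact ⟨fun h _ m hm _ => h m hm, fun h n hn => h n n hn le_rfl⟩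
  have hlim : Tendsto (fun n => P.real {ω | (fun j => Y j ω) ∈ sumsPos n}) atTop
      (𝓝 (P.real {ω | ∀ n, 1 ≤ n → 0 < ∑ j ∈ Finset.range n, Y j ω})) := by
    rw [hInter]
    refine (ENNReal.tendsto_toReal (measure_ne_top _ _)).comp (tendsto_measure_iInter_atTop
      (fun n => (hYm (measurableSet_sumsPos n)).nullMeasurableSet) ?_ ⟨0, measure_ne_top _ _⟩)
    exact fun m n hmn ω h k hk hkm => h k hk (hkm.trans hmn)
  have hs' : Summable fun n : ℕ => (1 - a n) / ((n : ℝ) + 1) :=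
    hs.congr fun n => by rw [ha1, one_div_mul_eq_div]
  have hC : boundaryC (x / σ) = Real.exp (∑' n : ℕ, (1 - a n) / ((n : ℝ) + 1)) := by
    rw [boundaryC]
    exact congrArg Real.exp (tsum_congr fun n => by rw [ha1, one_div_mul_eq_div])
  rw [hC]
  exact limit_of_convolution_recursion
    (q := fun n => P.real {ω | (fun j => Y j ω) ∈ sumsPos n}) (a := a)
    (fun n => measureReal_nonneg) (fun n => measureReal_le_one) ha0
    ha2 real_sumsPos_zero hrec hs' hlim

end RandomWalk

/-! ### First passage times and minima of running means. -/

section CrossTime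

/-- The first time `n ≥ 1` at which the running mean is at most `a` (`0` if there is none). -/
noncomputable def crossTime (z : ℕ → ℝ) (a : ℝ) : ℕ :=
  sInf {n | 1 ≤ n ∧ runningMean z n ≤ a}

variable {z : ℕ → ℝ} {a : ℝ}

theorem crossTime_spec (h : ∃ n, 1 ≤ n ∧ runningMean z n ≤ a) :
    1 ≤ crossTime z a ∧ runningMean z (crossTime z a) ≤ a :=
  Nat.sInf_mem h

theorem lt_runningMean_of_lt_crossTime {n : ℕ} (hn : 1 ≤ n) (h : n < crossTime z a) :
    a < runningMean z n := by
  by_contra hc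
  exact Nat.notMem_of_lt_sInf h ⟨hn, not_lt.1 hc⟩

theorem lt_runningMean_iff {n : ℕ} (hn : 1 ≤ n) :
    a < runningMean z n ↔ 0 < ∑ j ∈ Finset.range n, (z j - a) := by
  have : (0 : ℝ) < n := by exact_mod_cast hn
  rw [runningMean, lt_div_iff₀ this, Finset.sum_sub_distrib, Finset.sum_const, Finset.card_range,
    nsmul_eq_mul, sub_pos, mul_comm]

theorem measurable_runningMean (n : ℕ) : Measurable fun z : ℕ → ℝ => runningMean z n := by
  unfold runningMean
  fun_prop

/-- Existence of a crossing excludes the default value 0, for which the left side would always fail.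
-/
theorem lt_crossTime_iff (h : ∃ n, 1 ≤ n ∧ runningMean z n ≤ a) (n : ℕ) :
    n < crossTime z a ↔ (fun j => z j - a) ∈ sumsPos n := by
  constructor
  · intro hn m hm hmn
    exact (lt_runningMean_iff hm).1 (lt_runningMean_of_lt_crossTime hm (hmn.trans_lt hn))
  · intro hn
    by_contra hc
    obtain ⟨h1, h2⟩ := crossTime_spec h
    exact absurd ((lt_runningMean_iff h1).2 (hn _ h1 (not_lt.1 hc))) (not_lt.2 h2)

theorem measurable_crossTime (a : ℝ) : Measurable fun z => crossTime z a := by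
  have hE : ∀ n, MeasurableSet {z : ℕ → ℝ | 1 ≤ n ∧ runningMean z n ≤ a} := fun n =>
    (MeasurableSet.const _).inter (measurableSet_le (measurable_runningMean n) measurable_const)
  refine measurable_to_nat fun w => ?_
  set k := crossTime w a
  rcases Nat.eq_zero_or_pos k with hk | hk
  · have : (fun z => crossTime z a) ⁻¹' {k} =
        (⋃ n, {z : ℕ → ℝ | 1 ≤ n ∧ runningMean z n ≤ a})ᶜ := by
      ext z
      simp only [Set.mem_preimage, Set.mem_singleton_iff, Set.mem_compl_iff, Set.mem_iUnion, hk]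
      constructor
      · intro h hex
        have := (crossTime_spec hex).1
        omega
      · intro h
        rw [crossTime, Nat.sInf_eq_zero]
        exact Or.inr (Set.eq_empty_of_forall_notMem fun n hn => h ⟨n, hn⟩)
    rw [this]
    exact (MeasurableSet.iUnion hE).compl
  · have : (fun z => crossTime z a) ⁻¹' {k} = {z : ℕ → ℝ | 1 ≤ k ∧ runningMean z k ≤ a} ∩
        ⋂ m, ⋂ (_ : m < k), {z : ℕ → ℝ | 1 ≤ m ∧ runningMean z m ≤ a}ᶜ := by
      ext z
      simp only [Set.mem_preimage, Set.mem_singleton_iff, Set.mem_inter_iff, Set.mem_iInter,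
        Set.mem_compl_iff]
      constructor
      · intro h
        have hne : ∃ n, 1 ≤ n ∧ runningMean z n ≤ a := by
          by_contra hc
          have : crossTime z a = 0 := by
            rw [crossTime, Nat.sInf_eq_zero]
            exact Or.inr (Set.eq_empty_of_forall_notMem fun n hn => hc ⟨n, hn⟩)
          omega
        have := crossTime_spec hne
        rw [h] at this
        exact ⟨this, fun m hm => Nat.notMem_of_lt_sInf (h.symm ▸ hm)⟩
      · rintro ⟨h1, h2⟩
        refine le_antisymm (Nat.sInf_le h1) (le_of_not_gt fun hlt => ?_)
        exact h2 _ hlt (crossTime_spec ⟨k, h1⟩)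
    rw [this]
    exact (hE k).inter (MeasurableSet.iInter fun m => MeasurableSet.iInter fun _ => (hE m).compl)

/-- If the running means converge to a limit above one of them, they have a last minimiser. -/
theorem exists_last_argmin {m : ℝ} (hlim : Tendsto (runningMean z) atTop (𝓝 m))
    (hlt : ∃ n, 1 ≤ n ∧ runningMean z n < m) :
    ∃ M, 1 ≤ M ∧ (∀ n, 1 ≤ n → runningMean z M ≤ runningMean z n) ∧
      ∀ n, M < n → runningMean z M < runningMean z n := by
  -- Levels strictly below the limit are visited only finitely often, so a minimum is attained and
  -- has a last index.
  have hfin : ∀ b < m, {n | 1 ≤ n ∧ runningMean z n ≤ b}.Finite := by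
    intro b hb
    obtain ⟨N, hN⟩ := eventually_atTop.1 (hlim.eventually (lt_mem_nhds hb))
    refine (Set.finite_lt_nat N).subset fun n hn => ?_
    by_contra hc
    exact absurd (hN n (not_lt.1 hc)) (not_lt.2 hn.2)
  obtain ⟨n1, hn1, hn1m⟩ := hlt
  obtain ⟨M0, ⟨hM01, hM02⟩, hM0⟩ := Set.exists_min_image _ (runningMean z) (hfin _ hn1m)
    ⟨n1, hn1, le_rfl⟩
  have hmin : ∀ n, 1 ≤ n → runningMean z M0 ≤ runningMean z n := by
    intro n hn
    rcases le_total (runningMean z n) (runningMean z n1) with h | h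
    · exact hM0 n ⟨hn, h⟩
    · exact hM02.trans h
  obtain ⟨M, ⟨hM1, hM2⟩, hM⟩ := Set.exists_max_image _ id (hfin _ (hM02.trans_lt hn1m))
    ⟨M0, hM01, le_rfl⟩
  refine ⟨M, hM1, fun n hn => hM2.trans (hmin n hn), fun n hn => ?_⟩
  by_contra hc
  exact absurd (hM n ⟨by omega, (not_lt.1 hc).trans hM2⟩) (not_le.2 hn)

theorem minRunningMeanGT_iff {m : ℝ} (hlim : Tendsto (runningMean z) atTop (𝓝 m))
    (hlt : ∃ n, 1 ≤ n ∧ runningMean z n < m) :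
    MinRunningMeanGT z a ↔ ∀ n, 1 ≤ n → a < runningMean z n := by
  constructor
  · rintro ⟨b, hb, hab⟩ n hn
    exact hab.trans_le (hb.2 ⟨n, hn, rfl⟩)
  · intro h
    obtain ⟨M, hM1, hM2, -⟩ := exists_last_argmin hlim hlt
    refine ⟨runningMean z M, ⟨⟨M, hM1, rfl⟩, ?_⟩, h M hM1⟩
    rintro y ⟨n, hn, rfl⟩
    exact hM2 n hn

end CrossTime

/-! ### Running means of one Gaussian alternative. -/

section GaussianRow

variable {Ω : Type*} [MeasurableSpace Ω] {P : Measure Ω}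

/-- Tail-sum formula, turning a mean passage time into a sum of survival probabilities. -/
theorem lintegral_natCast_eq_tsum {K : Ω → ℕ} (hK : Measurable K) :
    ∫⁻ ω, (K ω : ENNReal) ∂P = ∑' n, P {ω | n < K ω} := by
  have hm : ∀ n, MeasurableSet {ω | n < K ω} := fun n => measurableSet_lt measurable_const hK
  have h1 : ∀ ω, (K ω : ENNReal) = ∑' n, Set.indicator {ω | n < K ω} (fun _ => 1) ω := by
    intro ω
    rw [tsum_eq_sum (s := Finset.range (K ω))]
    · rw [Finset.sum_congr rfl (g := fun _ => 1)]
      · simp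
      · intro n hn
        exact Set.indicator_of_mem (s := {ω | n < K ω}) (Finset.mem_range.1 hn) _
    · intro n hn
      exact Set.indicator_of_notMem (s := {ω | n < K ω}) (fun h => hn (Finset.mem_range.2 h)) _
  simp_rw [h1]
  rw [lintegral_tsum fun n => (measurable_const.indicator (hm n)).aemeasurable]
  exact tsum_congr fun n => lintegral_indicator_one (hm n)

variable {Y : ℕ → Ω → ℝ} {m σ : ℝ}

theorem iIndepFun_sub_const (hind : iIndepFun Y P) (c : ℝ) :
    iIndepFun (fun j ω => Y j ω - c) P :=
  hind.comp (fun _ y => y - c) fun _ => measurable_id.sub_const c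

theorem map_sub_const_eq_gaussianReal (hY : ∀ j, Measurable (Y j))
    (hlaw : ∀ j, P.map (Y j) = gaussianReal m (σ ^ 2).toNNReal) (c : ℝ) (j : ℕ) :
    P.map (fun ω => Y j ω - c) = gaussianReal (m - c) (σ ^ 2).toNNReal := by
  rw [← gaussianReal_map_sub_const, ← hlaw j, Measure.map_map (by fun_prop) (hY j)]
  rfl

theorem real_forall_lt_runningMean [IsProbabilityMeasure P] (hY : ∀ j, Measurable (Y j))
    (hind : iIndepFun Y P)
    (hσ : 0 < σ) (hlaw : ∀ j, P.map (Y j) = gaussianReal m (σ ^ 2).toNNReal) {x : ℝ} (hx : 0 < x) :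
    P.real {ω | ∀ n, 1 ≤ n → m - x < runningMean (fun j => Y j ω) n} = (boundaryC (x / σ))⁻¹ := by
  rw [← real_forall_sum_pos (fun j => (hY j).sub_const (m - x)) (iIndepFun_sub_const hind _) hx hσ
    fun j => by rw [map_sub_const_eq_gaussianReal hY hlaw, sub_sub_cancel]]
  congr 1
  ext ω
  exact forall_congr' fun n => forall_congr' fun hn => lt_runningMean_iff hn

/-- The survival probabilities are summable, hence tend to 0. -/
theorem ae_exists_runningMean_le [IsProbabilityMeasure P] (hY : ∀ j, Measurable (Y j))
    (hind : iIndepFun Y P)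
    (hσ : 0 < σ) (hlaw : ∀ j, P.map (Y j) = gaussianReal m (σ ^ 2).toNNReal) {x : ℝ} (hx : 0 < x) :
    ∀ᵐ ω ∂P, ∃ n, 1 ≤ n ∧ runningMean (fun j => Y j ω) n ≤ m + x := by
  have hs := hasSum_real_sumsPos (fun j => (hY j).sub_const (m + x)) (iIndepFun_sub_const hind _)
    hx hσ fun j => by rw [map_sub_const_eq_gaussianReal hY hlaw, sub_add_cancel_left]
  have h0 := hs.summable.tendsto_atTop_zero
  rw [ae_iff, ← measureReal_eq_zero_iff]
  refine le_antisymm (ge_of_tendsto' h0 fun n => measureReal_mono fun ω hω k hk _ => ?_)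
    measureReal_nonneg
  rw [← lt_runningMean_iff (z := fun j => Y j ω) hk]
  by_contra hc
  exact hω ⟨k, hk, not_lt.1 hc⟩

theorem integrable_crossTime_and_integral_eq [IsProbabilityMeasure P] (hY : ∀ j, Measurable (Y j))
    (hind : iIndepFun Y P)
    (hσ : 0 < σ) (hlaw : ∀ j, P.map (Y j) = gaussianReal m (σ ^ 2).toNNReal) {x : ℝ} (hx : 0 < x) :
    Integrable (fun ω => (crossTime (fun j => Y j ω) (m + x) : ℝ)) P ∧
      ∫ ω, (crossTime (fun j => Y j ω) (m + x) : ℝ) ∂P = boundaryC (x / σ) := by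
  have hK : Measurable fun ω => crossTime (fun j => Y j ω) (m + x) :=
    (measurable_crossTime _).comp (measurable_pi_lambda _ hY)
  have hs := hasSum_real_sumsPos (fun j => (hY j).sub_const (m + x)) (iIndepFun_sub_const hind _)
    hx hσ fun j => by rw [map_sub_const_eq_gaussianReal hY hlaw, sub_add_cancel_left]
  have hlint : ∫⁻ ω, ENNReal.ofReal (crossTime (fun j => Y j ω) (m + x) : ℝ) ∂P =
      ENNReal.ofReal (boundaryC (x / σ)) := by
    simp_rw [ENNReal.ofReal_natCast]
    rw [lintegral_natCast_eq_tsum hK, ← hs.tsum_eq,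
      ENNReal.ofReal_tsum_of_nonneg (fun _ => measureReal_nonneg) hs.summable]
    refine tsum_congr fun n => ?_
    rw [ofReal_measureReal]
    refine measure_congr ?_
    filter_upwards [ae_exists_runningMean_le hY hind hσ hlaw hx] with ω hω
    exact propext (lt_crossTime_iff hω n)
  have hKr : Measurable fun ω => (crossTime (fun j => Y j ω) (m + x) : ℝ) :=
    measurable_from_nat.comp hK
  constructor
  · refine ⟨hKr.aestronglyMeasurable, ?_⟩
    rw [hasFiniteIntegral_iff_ofReal (ae_of_all _ fun ω => Nat.cast_nonneg _), hlint]
    exact ENNReal.ofReal_lt_top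
  · rw [integral_eq_lintegral_of_nonneg_ae (ae_of_all _ fun ω => Nat.cast_nonneg _)
      hKr.aestronglyMeasurable, hlint,
      ENNReal.toReal_ofReal (zero_le_one.trans (one_lt_boundaryC (div_pos hx hσ)).le)]

theorem ae_tendsto_runningMean (hY : ∀ j, Measurable (Y j)) (hind : iIndepFun Y P)
    (hlaw : ∀ j, P.map (Y j) = gaussianReal m (σ ^ 2).toNNReal) :
    ∀ᵐ ω ∂P, Tendsto (runningMean fun j => Y j ω) atTop (𝓝 m) := by
  have hint : Integrable (Y 0) P := by
    have h : Integrable id (P.map (Y 0)) := by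
      rw [hlaw]
      exact memLp_one_iff_integrable.1 (memLp_id_gaussianReal 1)
    exact h.comp_measurable (hY 0)
  have hmean : ∫ ω, Y 0 ω ∂P = m := by
    rw [← integral_map (f := fun x => x) (hY 0).aemeasurable (by fun_prop), hlaw]
    exact integral_id_gaussianReal
  have := strong_law_ae_real Y hint (fun i j hij => hind.indepFun hij)
    fun i => ⟨(hY i).aemeasurable, (hY 0).aemeasurable, by rw [hlaw, hlaw]⟩
  rw [hmean] at this
  exact this

/-- Never going below `m` implies staying above `m - x * σ` for each `x > 0`, which has probability
1/C(x), small as x → 0. This makes the running means attain their minimum. -/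
theorem ae_exists_runningMean_lt [IsProbabilityMeasure P] (hY : ∀ j, Measurable (Y j))
    (hind : iIndepFun Y P)
    (hσ : 0 < σ) (hlaw : ∀ j, P.map (Y j) = gaussianReal m (σ ^ 2).toNNReal) :
    ∀ᵐ ω ∂P, ∃ n, 1 ≤ n ∧ runningMean (fun j => Y j ω) n < m := by
  rw [ae_iff, ← measureReal_eq_zero_iff]
  refine le_antisymm (le_of_forall_pos_le_add fun ε hε => ?_) measureReal_nonneg
  obtain ⟨x, hx, h⟩ := exists_lt_boundaryC ε⁻¹
  rw [zero_add]
  calc _ ≤ P.real {ω | ∀ n, 1 ≤ n → m - x * σ < runningMean (fun j => Y j ω) n} := by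
        refine measureReal_mono fun ω hω n hn => ?_
        have : m ≤ runningMean (fun j => Y j ω) n := by
          by_contra hc
          exact hω ⟨n, hn, not_le.1 hc⟩
        linarith [mul_pos hx hσ]
    _ = (boundaryC x)⁻¹ := by
        rw [real_forall_lt_runningMean hY hind hσ hlaw (mul_pos hx hσ), mul_div_cancel_right₀ _ hσ.ne']
    _ ≤ ε := inv_le_of_inv_le₀ hε (h x hx le_rfl).le

theorem map_sum_range_succ_eq_gaussianReal (hY : ∀ j, Measurable (Y j)) (hind : iIndepFun Y P)
    (hlaw : ∀ j, P.map (Y j) = gaussianReal m (σ ^ 2).toNNReal) (n : ℕ) :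
    P.map (∑ j ∈ Finset.range (n + 1), Y j) =
      gaussianReal ((n + 1) * m) ((n + 1) * (σ ^ 2).toNNReal) := by
  induction n with
  | zero => simp [hlaw]
  | succ n ih =>
    rw [Finset.sum_range_succ, gaussianReal_add_gaussianReal_of_indepFun
      (hind.indepFun_finsetSum_of_notMem hY Finset.notMem_range_self) ih (hlaw _)]
    congr 1 <;> push_cast <;> ring

/-- Partial sums have no atoms. This rules out touching the critical level, where the comparison
with the budget is undecided. -/
theorem ae_runningMean_ne (hY : ∀ j, Measurable (Y j)) (hind : iIndepFun Y P) (hσ : 0 < σ)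
    (hlaw : ∀ j, P.map (Y j) = gaussianReal m (σ ^ 2).toNNReal) (t : ℝ) :
    ∀ᵐ ω ∂P, ∀ n, 1 ≤ n → runningMean (fun j => Y j ω) n ≠ t := by
  rw [ae_all_iff]
  rintro (_ | n)
  · exact ae_of_all _ fun ω h => absurd h (by omega)
  have hv : ((n : ℝ≥0) + 1) * (σ ^ 2).toNNReal ≠ 0 := by
    have : 0 < (σ ^ 2).toNNReal := Real.toNNReal_pos.2 (by positivity)
    positivity
  have := nullSingletonClass_gaussianReal (μ := (n + 1) * m) hv
  have h1 := Measure.ae_ne (gaussianReal ((n + 1) * m) ((n + 1) * (σ ^ 2).toNNReal)) ((n + 1) * t)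
  rw [← map_sum_range_succ_eq_gaussianReal hY hind hlaw n] at h1
  have h2 := ae_of_ae_map (by fun_prop) h1
  filter_upwards [h2] with ω hω _ h
  apply hω
  rw [← h, runningMean, Finset.sum_apply]
  push_cast
  field_simp

end GaussianRow

/-! ### Pathwise analysis of the greedy procedure. -/

section Greedy

variable {sel : ℕ → (ℕ → ℝ) → ℕ} {x : ℕ → ℕ → ℝ} {K : ℕ} {a b : ℝ}

/-- The alternative chosen by the greedy procedure after `t` passes of the loop. -/
noncomputable def greedyChoice (sel : ℕ → (ℕ → ℝ) → ℕ) (k : ℕ) (x : ℕ → ℕ → ℝ) (t : ℕ) : ℕ :=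
  sel k (sampleMeans x (greedySizes sel k x t))

theorem greedySizes_succ (k t : ℕ) :
    greedySizes sel k x (t + 1) = Function.update (greedySizes sel k x t)
      (greedyChoice sel k x t) (greedySizes sel k x t (greedyChoice sel k x t) + 1) := rfl

theorem greedySizes_succ_self (k t : ℕ) :
    greedySizes sel k x (t + 1) (greedyChoice sel k x t) =
      greedySizes sel k x t (greedyChoice sel k x t) + 1 := by
  rw [greedySizes_succ, Function.update_self]

theorem greedySizes_succ_of_ne {k t i : ℕ} (h : i ≠ greedyChoice sel k x t) :
    greedySizes sel k x (t + 1) i = greedySizes sel k x t i := by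
  rw [greedySizes_succ, Function.update_of_ne h]

theorem greedySizes_mono (k i : ℕ) : Monotone fun t => greedySizes sel k x t i := by
  refine monotone_nat_of_le_succ fun t => ?_
  by_cases h : i = greedyChoice sel k x t
  · rw [h, greedySizes_succ_self]
    omega
  · rw [greedySizes_succ_of_ne h]

theorem one_le_greedySizes (k t i : ℕ) : 1 ≤ greedySizes sel k x t i :=
  greedySizes_mono (sel := sel) (x := x) k i (Nat.zero_le t)

theorem greedyChoice_lt (hsel : IsArgmaxRule sel) (t : ℕ) :
    greedyChoice sel (K + 1) x t < K + 1 :=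
  (hsel (K + 1) (by omega) _).1

theorem runningMean_le_greedyChoice (hsel : IsArgmaxRule sel) (t : ℕ) {i : ℕ} (hi : i < K + 1) :
    runningMean (x i) (greedySizes sel (K + 1) x t i) ≤
      runningMean (x (greedyChoice sel (K + 1) x t))
        (greedySizes sel (K + 1) x t (greedyChoice sel (K + 1) x t)) :=
  (hsel (K + 1) (Nat.succ_pos K) (sampleMeans x (greedySizes sel (K + 1) x t))).2 i hi

theorem sum_greedySizes (hsel : IsArgmaxRule sel) (t : ℕ) :
    ∑ i ∈ Finset.range (K + 1), greedySizes sel (K + 1) x t i = K + 1 + t := by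
  induction t with
  | zero => simp [greedySizes]
  | succ t ih =>
    have hmem : greedyChoice sel (K + 1) x t ∈ Finset.range (K + 1) :=
      Finset.mem_range.2 (greedyChoice_lt hsel t)
    rw [greedySizes_succ, Finset.sum_update_of_mem hmem]
    rw [← Finset.add_sum_erase _ _ hmem, ← Finset.sdiff_singleton_eq_erase] at ih
    omega

theorem greedySizes_zero_add_sum (hsel : IsArgmaxRule sel) (t : ℕ) :
    greedySizes sel (K + 1) x t 0 + ∑ i ∈ Finset.range K, greedySizes sel (K + 1) x t (i + 1) =
      K + 1 + t := by
  rw [← sum_greedySizes (x := x) hsel t, Finset.sum_range_succ', add_comm]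

/-- While alternative `0` is above `a`, an alternative that has reached a mean at most `a` cannot be
a maximiser, so it is not sampled again. -/
theorem greedySizes_le_crossTime (hsel : IsArgmaxRule sel)
    (hcross : ∀ i < K, ∃ n, 1 ≤ n ∧ runningMean (x (i + 1)) n ≤ a) (t : ℕ)
    (h0 : ∀ u < t, a < runningMean (x 0) (greedySizes sel (K + 1) x u 0)) :
    ∀ i < K, greedySizes sel (K + 1) x t (i + 1) ≤ crossTime (x (i + 1)) a := by
  induction t with
  | zero => exact fun i hi => (crossTime_spec (hcross i hi)).1
  | succ t ih =>
    intro i hi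
    have ih' := ih (fun u hu => h0 u (by omega)) i hi
    by_cases h : i + 1 = greedyChoice sel (K + 1) x t
    · rw [h, greedySizes_succ_self, ← h]
      refine lt_of_le_of_ne ih' fun heq => ?_
      have h1 := runningMean_le_greedyChoice (x := x) hsel t (Nat.succ_pos K)
      rw [← h, heq] at h1
      exact absurd (h1.trans (crossTime_spec (hcross i hi)).2) (not_le.2 (h0 t (by omega)))
    · rwa [greedySizes_succ_of_ne h]

/-- When alternative `0` received its observation number `M + 1`, its mean was maximal, so the
others were at most its value at `M`. Later its mean is strictly larger, so it is always chosen and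
the others are frozen. -/
theorem runningMean_le_of_lt_greedySizes (hsel : IsArgmaxRule sel) {M : ℕ} (hM1 : 1 ≤ M)
    (hM : ∀ n, M < n → runningMean (x 0) M < runningMean (x 0) n) (t : ℕ)
    (ht : M < greedySizes sel (K + 1) x t 0) :
    ∀ i < K, runningMean (x (i + 1)) (greedySizes sel (K + 1) x t (i + 1)) ≤
      runningMean (x 0) M := by
  induction t with
  | zero => exact absurd ht (not_lt.2 hM1)
  | succ t ih =>
    intro i hi
    have hchoice : greedyChoice sel (K + 1) x t = 0 ∧
        runningMean (x (i + 1)) (greedySizes sel (K + 1) x t (i + 1)) ≤ runningMean (x 0) M := by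
      rcases Nat.lt_or_ge M (greedySizes sel (K + 1) x t 0) with h | h
      · refine ⟨?_, ih h i hi⟩
        by_contra hne
        obtain ⟨s, hs⟩ := Nat.exists_eq_succ_of_ne_zero hne
        have hsK := greedyChoice_lt (K := K) (x := x) hsel t
        have h1 := runningMean_le_greedyChoice (x := x) hsel t (Nat.succ_pos K)
        rw [hs] at h1 hsK
        exact absurd (h1.trans (ih h s (by omega))) (not_le.2 (hM _ h))
      · have h0 : greedyChoice sel (K + 1) x t = 0 := by
          by_contra hne
          rw [greedySizes_succ_of_ne (Ne.symm hne)] at ht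
          omega
        have hself := greedySizes_succ_self (sel := sel) (x := x) (K + 1) t
        rw [h0] at hself
        have hMeq : greedySizes sel (K + 1) x t 0 = M := by omega
        have h1 := runningMean_le_greedyChoice (x := x) hsel t (Nat.succ_lt_succ hi)
        rw [h0, hMeq] at h1
        exact ⟨h0, h1⟩
    rw [greedySizes_succ_of_ne (by omega)]
    exact hchoice.2

/-- If the running means of alternative `0` stay above `a` and the budget suffices to push all other
alternatives below `a`, then alternative `0` is chosen. -/
theorem greedyChoice_eq_zero (hsel : IsArgmaxRule sel)
    (hcross : ∀ i < K, ∃ n, 1 ≤ n ∧ runningMean (x (i + 1)) n ≤ a)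
    (ha : ∀ n, 1 ≤ n → a < runningMean (x 0) n) {M : ℕ} (hM1 : 1 ≤ M)
    (hM : ∀ n, M < n → runningMean (x 0) M < runningMean (x 0) n) {t : ℕ}
    (ht : ∑ i ∈ Finset.range K, crossTime (x (i + 1)) a + M < K + 1 + t) :
    greedyChoice sel (K + 1) x t = 0 := by
  have h1 : ∑ i ∈ Finset.range K, greedySizes sel (K + 1) x t (i + 1) ≤
      ∑ i ∈ Finset.range K, crossTime (x (i + 1)) a :=
    Finset.sum_le_sum fun i hi => greedySizes_le_crossTime hsel hcross t
      (fun u _ => ha _ (one_le_greedySizes _ _ _)) i (Finset.mem_range.1 hi)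
  have h2 := greedySizes_zero_add_sum (x := x) (K := K) hsel t
  have h3 : M < greedySizes sel (K + 1) x t 0 := by omega
  by_contra hne
  obtain ⟨s, hs⟩ := Nat.exists_eq_succ_of_ne_zero hne
  have hsK := greedyChoice_lt (K := K) (x := x) hsel t
  have h4 := runningMean_le_greedyChoice (x := x) hsel t (Nat.succ_pos K)
  rw [hs] at h4 hsK
  exact absurd (h4.trans (runningMean_le_of_lt_greedySizes hsel hM1 hM t h3 s (by omega)))
    (not_le.2 (hM _ h3))

/-- Sample sizes grow by at most one per pass, so size `m` was held and then left through a choice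
of alternative `0`. -/
theorem exists_greedyChoice_eq_zero {m t : ℕ} (hm : 1 ≤ m)
    (ht : m < greedySizes sel (K + 1) x t 0) :
    ∃ u < t, greedySizes sel (K + 1) x u 0 = m ∧ greedyChoice sel (K + 1) x u = 0 := by
  induction t with
  | zero => exact absurd ht (not_lt.2 hm)
  | succ t ih =>
    rcases Nat.lt_or_ge m (greedySizes sel (K + 1) x t 0) with h | h
    · obtain ⟨u, hu, h1⟩ := ih h
      exact ⟨u, by omega, h1⟩
    · have h0 : greedyChoice sel (K + 1) x t = 0 := by
        by_contra hne
        rw [greedySizes_succ_of_ne (Ne.symm hne)] at ht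
        omega
      have hself := greedySizes_succ_self (sel := sel) (x := x) (K + 1) t
      rw [h0] at hself
      exact ⟨t, by omega, by omega, h0⟩

/-- If alternative `0` falls to a level `a` below which the budget cannot push all other
alternatives, then it is not chosen. -/
theorem greedyChoice_ne_zero (hsel : IsArgmaxRule sel) {m t : ℕ} (hm : 1 ≤ m)
    (ha : runningMean (x 0) m ≤ a)
    (hbudget : K + 1 + t ≤ ∑ i ∈ Finset.range K, crossTime (x (i + 1)) a)
    (hb : m = 1 ∨ (∀ i < K, ∃ n, 1 ≤ n ∧ runningMean (x (i + 1)) n ≤ b) ∧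
      (∀ n, 1 ≤ n → n < m → b < runningMean (x 0) n) ∧
      ∑ i ∈ Finset.range K, crossTime (x (i + 1)) b + m ≤ K + 1 + t) :
    greedyChoice sel (K + 1) x t ≠ 0 := by
  intro h0
  -- With fewer than `m` observations, alternative `0` has stayed above `b`, so the others used at
  -- most their passage times to `b` and the total is too small. With at least `m`, it was chosen at
  -- size exactly `m`, when all others were already at or below `a`, which costs more than the
  -- budget.
  rcases Nat.lt_or_ge (greedySizes sel (K + 1) x t 0) m with hlt | hge
  · have hone := one_le_greedySizes (sel := sel) (x := x) (K + 1) t 0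
    rcases hb with rfl | ⟨hcross, habove, hle⟩
    · omega
    · have h1 : ∑ i ∈ Finset.range K, greedySizes sel (K + 1) x t (i + 1) ≤
          ∑ i ∈ Finset.range K, crossTime (x (i + 1)) b :=
        Finset.sum_le_sum fun i hi => greedySizes_le_crossTime hsel hcross t
          (fun u hu => habove _ (one_le_greedySizes _ _ _)
            ((greedySizes_mono (sel := sel) (x := x) (K + 1) 0 hu.le).trans_lt hlt))
          i (Finset.mem_range.1 hi)
      have h2 := greedySizes_zero_add_sum (x := x) (K := K) hsel t
      omega
  · obtain ⟨u, hut, hum, hu0⟩ : ∃ u ≤ t, greedySizes sel (K + 1) x u 0 = m ∧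
        greedyChoice sel (K + 1) x u = 0 := by
      rcases hge.eq_or_lt with h | h
      · exact ⟨t, le_rfl, h.symm, h0⟩
      · obtain ⟨u, hu, h1⟩ := exists_greedyChoice_eq_zero hm h
        exact ⟨u, hu.le, h1⟩
    have h1 : ∑ i ∈ Finset.range K, crossTime (x (i + 1)) a ≤
        ∑ i ∈ Finset.range K, greedySizes sel (K + 1) x u (i + 1) := by
      refine Finset.sum_le_sum fun i hi => Nat.sInf_le ⟨one_le_greedySizes _ _ _, ?_⟩
      have h2 := runningMean_le_greedyChoice (x := x) hsel u
        (Nat.succ_lt_succ (Finset.mem_range.1 hi))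
      rw [hu0, hum] at h2
      exact h2.trans ha
    have h2 := greedySizes_zero_add_sum (x := x) (K := K) hsel u
    omega

end Greedy

/-! ### Independence of the alternatives and the law of large numbers for passage times. -/

section Rows

variable {Ω : Type*} [MeasurableSpace Ω] {P : Measure Ω} {X : ℕ → ℕ → Ω → ℝ}

theorem iIndepFun_row (hindep : iIndepFun (fun p : ℕ × ℕ => X p.1 p.2) P) (i : ℕ) :
    iIndepFun (X i) P :=
  hindep.precomp (g := fun j => (i, j)) fun _ _ h => (Prod.mk.inj h).2

theorem indepFun_rows (hmeas : ∀ i j, Measurable (X i j))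
    (hindep : iIndepFun (fun p : ℕ × ℕ => X p.1 p.2) P) {i i' : ℕ} (h : i ≠ i') :
    IndepFun (fun ω j => X i j ω) (fun ω j => X i' j ω) P := by
  rw [IndepFun_iff_Indep]
  have hdisj : Disjoint {p : ℕ × ℕ | p.1 = i} {p : ℕ × ℕ | p.1 = i'} :=
    Set.disjoint_left.2 fun p hp hp' => h (hp.symm.trans hp')
  have key := indep_iSup_of_disjoint (fun p : ℕ × ℕ => (hmeas p.1 p.2).comap_le)
    ((iIndepFun_iff_iIndep _ _ _).1 hindep) hdisj
  have hle : ∀ i, MeasurableSpace.comap (fun ω j => X i j ω) MeasurableSpace.pi ≤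
      ⨆ p ∈ {p : ℕ × ℕ | p.1 = i}, MeasurableSpace.comap (X p.1 p.2) inferInstance := by
    intro i
    rw [MeasurableSpace.pi, MeasurableSpace.comap_iSup]
    refine iSup_le fun j => ?_
    rw [MeasurableSpace.comap_comp]
    exact le_iSup₂_of_le (i, j) rfl le_rfl
  exact indep_of_indep_of_le_left (indep_of_indep_of_le_right key (hle i')) (hle i)

theorem identDistrib_rows [IsProbabilityMeasure P] (hmeas : ∀ i j, Measurable (X i j))
    (hindep : iIndepFun (fun p : ℕ × ℕ => X p.1 p.2) P) {i i' : ℕ}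
    (h : ∀ j, P.map (X i j) = P.map (X i' j)) :
    IdentDistrib (fun ω j => X i j ω) (fun ω j => X i' j ω) P P where
  aemeasurable_fst := (measurable_pi_lambda _ (hmeas i)).aemeasurable
  aemeasurable_snd := (measurable_pi_lambda _ (hmeas i')).aemeasurable
  map_eq := by
    rw [(iIndepFun_row hindep i).map_fun_eq_infinitePi_map (hmeas i),
      (iIndepFun_row hindep i').map_fun_eq_infinitePi_map (hmeas i')]
    simp_rw [h]

/-- The number of observations per alternative that push `K` alternatives with mean `m` to level
`m + x` converges to `C (x / σ)`. -/
theorem ae_tendsto_sum_crossTime_div [IsProbabilityMeasure P] (hmeas : ∀ i j, Measurable (X i j))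
    (hindep : iIndepFun (fun p : ℕ × ℕ => X p.1 p.2) P) {m σ x : ℝ} (hσ : 0 < σ) (hx : 0 < x)
    (hlaw : ∀ i j, P.map (X (i + 1) j) = gaussianReal m (σ ^ 2).toNNReal) :
    ∀ᵐ ω ∂P, Tendsto (fun K : ℕ => ((∑ i ∈ Finset.range K,
      crossTime (fun j => X (i + 1) j ω) (m + x) : ℕ) : ℝ) / ((K : ℝ) + 1)) atTop
      (𝓝 (boundaryC (x / σ))) := by
  have hF : Measurable fun z : ℕ → ℝ => (crossTime z (m + x) : ℝ) :=
    measurable_from_nat.comp (measurable_crossTime _)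
  obtain ⟨hint, hval⟩ := integrable_crossTime_and_integral_eq (hmeas 1)
    (iIndepFun_row hindep 1) hσ (hlaw 0) hx
  have hslln := strong_law_ae_real
    (fun i ω => (crossTime (fun j => X (i + 1) j ω) (m + x) : ℝ)) hint
    (fun i i' h => (indepFun_rows hmeas hindep fun he => h (Nat.succ_injective he)).comp hF hF)
    (fun i => (identDistrib_rows hmeas hindep (i := i + 1) (i' := 0 + 1)
      fun j => by rw [hlaw, hlaw]).comp hF)
  filter_upwards [hslln] with ω hω
  -- The factor K/(K + 1) changes the normalisation to the number of all alternatives.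
  have h1 := hω.mul (tendsto_natCast_div_add_atTop (1 : ℝ))
  rw [mul_one] at h1
  change Tendsto _ _ (𝓝 (∫ ω, (crossTime (fun j => X 1 j ω) (m + x) : ℝ) ∂P)) at h1
  rw [hval] at h1
  refine h1.congr' ?_
  filter_upwards [eventually_ne_atTop 0] with K hK
  have : (K : ℝ) ≠ 0 := by exact_mod_cast hK
  push_cast
  field_simp

end Rows

/-! ### Asymptotics of the budget. -/

section Budget

/-- The initial observations are always taken, so the number of observations is the maximum of `K +
1` and the budget; truncated subtraction encodes this. -/
theorem tendsto_greedyBudget_div {c : ℝ} (hc : 0 ≤ c) :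
    Tendsto (fun K : ℕ => ((K + 1 + (⌊c * ((K + 1 : ℕ) : ℝ)⌋₊ - (K + 1)) : ℕ) : ℝ) / ((K : ℝ) + 1))
      atTop (𝓝 (max 1 c)) := by
  have h1 : Tendsto (fun K : ℕ => ((K + 1 : ℕ) : ℝ)) atTop atTop :=
    tendsto_natCast_atTop_atTop.comp (tendsto_add_atTop_nat 1)
  have h2 := ((tendsto_const_nhds (x := (1 : ℝ))).max
    ((tendsto_nat_floor_mul_div_atTop hc).comp h1))
  refine h2.congr fun K => ?_
  have hK : (0 : ℝ) < (K : ℝ) + 1 := by positivity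
  have h3 : K + 1 + (⌊c * ((K + 1 : ℕ) : ℝ)⌋₊ - (K + 1)) =
      max (K + 1) ⌊c * ((K + 1 : ℕ) : ℝ)⌋₊ := by omega
  rw [h3, Nat.cast_max, ← max_div_div_right hK.le, Function.comp_apply]
  push_cast
  rw [div_self hK.ne']

variable {S T : ℕ → ℕ} {s t : ℝ}

theorem eventually_add_lt_of_tendsto_div
    (hS : Tendsto (fun K => (S K : ℝ) / ((K : ℝ) + 1)) atTop (𝓝 s))
    (hT : Tendsto (fun K => (T K : ℝ) / ((K : ℝ) + 1)) atTop (𝓝 t)) (hst : s < t) (M : ℕ) :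
    ∀ᶠ K in atTop, S K + M < T K := by
  have hM : Tendsto (fun K : ℕ => (M : ℝ) / ((K : ℝ) + 1)) atTop (𝓝 0) :=
    tendsto_const_nhds.div_atTop (tendsto_atTop_add_const_right _ _ tendsto_natCast_atTop_atTop)
  have h := hS.add hM
  rw [add_zero] at h
  filter_upwards [h.eventually_lt hT hst] with K hK
  rw [← add_div, div_lt_div_iff_of_pos_right (by positivity)] at hK
  exact_mod_cast hK

end Budget

/-! ### From pathwise bounds to the limit of the PCS. -/

section Limit

variable {Ω : Type*} [MeasurableSpace Ω] {P : Measure Ω} [IsProbabilityMeasure P]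

/-- The sets `A k` need not be measurable, which accommodates arbitrary tie-breaking: they lie
between `G k` and the complement of `H k`, whose indicators both converge almost surely to that of
`E`. -/
theorem tendsto_measureReal_of_sandwich {A G H : ℕ → Set Ω} {E : Set Ω}
    (hG : ∀ k, MeasurableSet (G k)) (hH : ∀ k, MeasurableSet (H k)) (hE : MeasurableSet E)
    (hGA : ∀ k, G k ⊆ A k) (hHA : ∀ k, H k ⊆ (A k)ᶜ)
    (hEG : ∀ᵐ ω ∂P, ω ∈ E → ∀ᶠ k in atTop, ω ∈ G k)
    (hEH : ∀ᵐ ω ∂P, ω ∉ E → ∀ᶠ k in atTop, ω ∈ H k) :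
    Tendsto (fun k => P.real (A k)) atTop (𝓝 (P.real E)) := by
  have h1 := tendsto_measure_of_ae_tendsto_indicator (μ := P) atTop hE hG MeasurableSet.univ
    (measure_ne_top _ _) (Eventually.of_forall fun _ => Set.subset_univ _) (by
      filter_upwards [hEG, hEH] with ω h1 h2
      by_cases h : ω ∈ E
      · exact (h1 h).mono fun k hk => iff_of_true hk h
      · exact (h2 h).mono fun k hk => iff_of_false (fun hg => hHA k hk (hGA k hg)) h)
  have h2 := tendsto_measure_of_ae_tendsto_indicator (μ := P) atTop hE (fun k => (hH k).compl)
    MeasurableSet.univ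
    (measure_ne_top _ _) (Eventually.of_forall fun _ => Set.subset_univ _) (by
      filter_upwards [hEG, hEH] with ω h1 h2
      by_cases h : ω ∈ E
      · exact (h1 h).mono fun k hk => iff_of_true (fun hh => hHA k hh (hGA k hk)) h
      · exact (h2 h).mono fun k hk => iff_of_false (fun hh => hh hk) h)
  refine (ENNReal.tendsto_toReal (measure_ne_top _ _)).comp
    (tendsto_of_tendsto_of_tendsto_of_le_of_le h1 h2 (fun k => measure_mono (hGA k))
      fun k => measure_mono ?_)
  exact fun ω hω hh => hHA k hh hω

variable {X : ℕ → ℕ → Ω → ℝ} {sel : ℕ → (ℕ → ℝ) → ℕ} {m m0 σ c : ℝ}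

/-- The number of observations that pushes the alternatives `1, …, K` to level `a`. -/
noncomputable def totalCrossTime (X : ℕ → ℕ → Ω → ℝ) (a : ℝ) (K : ℕ) (ω : Ω) : ℕ :=
  ∑ i ∈ Finset.range K, crossTime (fun j => X (i + 1) j ω) a

/-- On `E` the budget suffices for a level that alternative `0` never reaches. Off `E` it does not
suffice for a level to which alternative `0` falls, yet suffices for one above which it stays until
then. Levels are `m + q` with `q` rational, so countably many null sets and measurable unions are
enough. -/
theorem tendsto_greedyPCS (hmeas : ∀ i j, Measurable (X i j))
    (hindep : iIndepFun (fun p : ℕ × ℕ => X p.1 p.2) P) (hσ : 0 < σ)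
    (hlaw0 : ∀ j, P.map (X 0 j) = gaussianReal m0 (σ ^ 2).toNNReal)
    (hlaw : ∀ i j, P.map (X (i + 1) j) = gaussianReal m (σ ^ 2).toNNReal)
    (hsel : IsArgmaxRule sel) (hc : 0 ≤ c) {E : Set Ω} (hE : MeasurableSet E)
    (hEG : ∀ᵐ ω ∂P, ω ∈ E → ∃ q : ℚ, (0 : ℝ) < q ∧ boundaryC (q / σ) < max 1 c ∧
      ∀ n, 1 ≤ n → m + q < runningMean (fun j => X 0 j ω) n)
    (hEH : ∀ᵐ ω ∂P, ω ∉ E → ∃ q q' : ℚ, ∃ n : ℕ, 1 ≤ n ∧ (0 : ℝ) < q ∧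
      max 1 c < boundaryC (q / σ) ∧ runningMean (fun j => X 0 j ω) n ≤ m + q ∧
      (n = 1 ∨ (0 : ℝ) < q' ∧ boundaryC (q' / σ) < max 1 c ∧
        ∀ k, 1 ≤ k → k < n → m + q' < runningMean (fun j => X 0 j ω) k)) :
    Tendsto (fun k : ℕ => greedyPCS P X sel k ⌊c * (k : ℝ)⌋₊) atTop (𝓝 (P.real E)) := by
  rw [← tendsto_add_atTop_iff_nat 1]
  obtain ⟨T, hT⟩ : ∃ T : ℕ → ℕ, ∀ K, T K = K + 1 + (⌊c * ((K + 1 : ℕ) : ℝ)⌋₊ - (K + 1)) :=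
    ⟨_, fun _ => rfl⟩
  have hTlim := tendsto_greedyBudget_div hc
  simp only [← hT] at hTlim
  have hrm : ∀ i n, Measurable fun ω => runningMean (fun j => X i j ω) n := fun i n =>
    (measurable_runningMean n).comp (measurable_pi_lambda _ (hmeas i))
  have hct : ∀ a K, Measurable fun ω => totalCrossTime X a K ω := fun a K =>
    Finset.measurable_fun_sum _ fun i _ =>
      (measurable_crossTime a).comp (measurable_pi_lambda _ (hmeas (i + 1)))
  have hcross : ∀ᵐ ω ∂P, ∀ q : ℚ, (0 : ℝ) < q → ∀ i, ∃ n, 1 ≤ n ∧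
      runningMean (fun j => X (i + 1) j ω) n ≤ m + q := by
    rw [ae_all_iff]
    intro q
    by_cases hq : (0 : ℝ) < q
    · have : ∀ i, ∀ᵐ ω ∂P, ∃ n, 1 ≤ n ∧ runningMean (fun j => X (i + 1) j ω) n ≤ m + q := fun i =>
        ae_exists_runningMean_le (hmeas _) (iIndepFun_row hindep _) hσ (hlaw i) hq
      filter_upwards [ae_all_iff.2 this] with ω hω _ using hω
    · exact ae_of_all _ fun ω h => absurd h hq
  have hsum : ∀ᵐ ω ∂P, ∀ q : ℚ, (0 : ℝ) < q →
      Tendsto (fun K : ℕ => (totalCrossTime X (m + q) K ω : ℝ) / ((K : ℝ) + 1)) atTop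
        (𝓝 (boundaryC (q / σ))) := by
    rw [ae_all_iff]
    intro q
    by_cases hq : (0 : ℝ) < q
    · filter_upwards [ae_tendsto_sum_crossTime_div hmeas hindep hσ hq hlaw] with ω hω _ using hω
    · exact ae_of_all _ fun ω h => absurd h hq
  refine tendsto_measureReal_of_sandwich (E := E)
    (G := fun K => {ω | ∃ q : ℚ, ∃ M : ℕ, 1 ≤ M ∧
      (∀ i < K, ∃ n, 1 ≤ n ∧ runningMean (fun j => X (i + 1) j ω) n ≤ m + q) ∧
      (∀ n, 1 ≤ n → m + q < runningMean (fun j => X 0 j ω) n) ∧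
      (∀ n, M < n → runningMean (fun j => X 0 j ω) M < runningMean (fun j => X 0 j ω) n) ∧
      totalCrossTime X (m + q) K ω + M < T K})
    (H := fun K => {ω | ∃ q q' : ℚ, ∃ n : ℕ, 1 ≤ n ∧
      runningMean (fun j => X 0 j ω) n ≤ m + q ∧ T K ≤ totalCrossTime X (m + q) K ω ∧
      (n = 1 ∨ (∀ i < K, ∃ n, 1 ≤ n ∧ runningMean (fun j => X (i + 1) j ω) n ≤ m + q') ∧
        (∀ k, 1 ≤ k → k < n → m + q' < runningMean (fun j => X 0 j ω) k) ∧
        totalCrossTime X (m + q') K ω + n ≤ T K)})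
    (fun K => by measurability) (fun K => by measurability) hE ?_ ?_ ?_ ?_
  · rintro K ω ⟨q, M, hM1, h1, h2, h3, h4⟩
    rw [hT] at h4
    exact greedyChoice_eq_zero (x := fun i j => X i j ω) hsel h1 h2 hM1 h3 h4
  · rintro K ω ⟨q, q', n, hn, h1, h2, h3⟩
    rw [hT] at h2 h3
    exact greedyChoice_ne_zero (x := fun i j => X i j ω) hsel hn h1 h2 h3
  · filter_upwards [hEG, hcross, hsum,
      ae_tendsto_runningMean (hmeas 0) (iIndepFun_row hindep 0) hlaw0,
      ae_exists_runningMean_lt (hmeas 0) (iIndepFun_row hindep 0) hσ hlaw0]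
      with ω h1 h2 h3 h4 h5 hω
    obtain ⟨q, hq, hqc, habove⟩ := h1 hω
    obtain ⟨M, hM1, -, hM⟩ := exists_last_argmin h4 h5
    filter_upwards [eventually_add_lt_of_tendsto_div (h3 q hq) hTlim hqc M] with K hK
    exact ⟨q, M, hM1, fun i _ => h2 q hq i, habove, hM, hK⟩
  · filter_upwards [hEH, hcross, hsum] with ω h1 h2 h3 hω
    obtain ⟨q, q', n, hn, hq, hqc, hle, hor⟩ := h1 hω
    have hA := eventually_add_lt_of_tendsto_div hTlim (h3 q hq) hqc 0
    rcases hor with h | ⟨hq', hqc', habove⟩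
    · filter_upwards [hA] with K hK
      exact ⟨q, q', n, hn, hle, hK.le, Or.inl h⟩
    · filter_upwards [hA, eventually_add_lt_of_tendsto_div (h3 q' hq') hTlim hqc' n] with K hK hK'
      exact ⟨q, q', n, hn, hle, hK.le, Or.inr ⟨fun i _ => h2 q' hq' i, habove, hK'.le⟩⟩

end Limit

/-! ### The critical level. -/

section Threshold

theorem boundaryC_lt_of_lt {σ x y : ℝ} (hσ : 0 < σ) (hx : 0 < x) (hxy : x < y) :
    boundaryC (y / σ) < boundaryC (x / σ) :=
  boundaryC_strictAntiOn (div_pos hx hσ) (div_pos (hx.trans hxy) hσ)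
    (div_lt_div_of_pos_right hxy hσ)

/-- Either `C (x / σ) > c` for all `x > 0`, or `C (· / σ)` crosses the level `c` at a point. -/
theorem boundaryC_threshold {σ : ℝ} (hσ : 0 < σ) (c : ℝ) :
    (∀ x > 0, c < boundaryC (x / σ)) ∨
      ∃ t > 0, (∀ x > t, boundaryC (x / σ) < c) ∧ ∀ x > 0, x < t → c < boundaryC (x / σ) := by
  -- Monotonicity replaces continuity: the crossing point is `sInf D`, and it is positive because C
  -- blows up at 0.
  set D : Set ℝ := {x | 0 < x ∧ boundaryC (x / σ) < c} with hD
  rcases D.eq_empty_or_nonempty with hemp | hne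
  · left
    intro x hx
    have h1 : c ≤ boundaryC ((x + 1) / σ) := by
      by_contra hc
      exact Set.notMem_empty (x + 1) (hemp ▸ ⟨by linarith, not_le.1 hc⟩)
    exact h1.trans_lt (boundaryC_lt_of_lt hσ hx (by linarith))
  · right
    obtain ⟨x0, hx0, h0⟩ := exists_lt_boundaryC c
    have hlow : ∀ x ∈ D, x0 * σ ≤ x := by
      intro x hx
      by_contra hc
      have h2 := h0 (x / σ) (div_pos hx.1 hσ) (by rw [div_le_iff₀ hσ]; exact (not_le.1 hc).le)
      exact absurd hx.2 (not_lt.2 h2.le)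
    refine ⟨sInf D, (mul_pos hx0 hσ).trans_le (le_csInf hne hlow), fun x hx => ?_,
      fun x hx hxt => ?_⟩
    · obtain ⟨d, hd, hdx⟩ := exists_lt_of_csInf_lt hne hx
      exact (boundaryC_lt_of_lt hσ hd.1 hdx).trans hd.2
    · obtain ⟨y, hxy, hyt⟩ := exists_between hxt
      have h1 : c ≤ boundaryC (y / σ) := by
        by_contra hc
        exact absurd (csInf_le ⟨_, hlow⟩ (show y ∈ D from ⟨hx.trans hxy, not_le.1 hc⟩))
          (not_le.2 hyt)
      exact h1.trans_lt (boundaryC_lt_of_lt hσ hx hxy)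

/-- The first passage to a level `≤ t` splits the levels around `t` by rational numbers. -/
theorem exists_rat_first_passage {z : ℕ → ℝ} {m t : ℝ} (ht : 0 < t)
    (hne : ∀ n, 1 ≤ n → runningMean z n ≠ m + t)
    (hex : ∃ n, 1 ≤ n ∧ runningMean z n ≤ m + t) :
    ∃ q q' : ℚ, ∃ n : ℕ, 1 ≤ n ∧ (0 : ℝ) < q ∧ q < t ∧ runningMean z n ≤ m + q ∧ t < q' ∧
      ∀ k, 1 ≤ k → k < n → m + q' < runningMean z k := by
  obtain ⟨hn1, hn2⟩ := crossTime_spec hex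
  set n := crossTime z (m + t)
  have hlt : runningMean z n < m + t := lt_of_le_of_ne hn2 (hne n hn1)
  -- The mean at `n` is strictly below `m + t`, which leaves room for a positive rational under `t`.
  obtain ⟨q, hq1, hq2⟩ := exists_rat_btwn (max_lt ht (by linarith : runningMean z n - m < t))
  -- Only finitely many earlier means have to stay above `m + y`, so some `y > t` works.
  have hev : ∀ᶠ y in 𝓝[>] t, ∀ k ∈ Finset.Ico 1 n, m + y < runningMean z k := by
    rw [Filter.eventually_all_finset]
    intro k hk
    obtain ⟨hk1, hk2⟩ := Finset.mem_Ico.1 hk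
    have h1 : t < runningMean z k - m := by
      linarith [lt_runningMean_of_lt_crossTime hk1 hk2]
    filter_upwards [Ioo_mem_nhdsGT h1] with y hy
    linarith [hy.2]
  obtain ⟨y, hy, hty⟩ := (hev.and self_mem_nhdsWithin).exists
  obtain ⟨q', hq'1, hq'2⟩ := exists_rat_btwn (show t < y from hty)
  refine ⟨q, q', n, hn1, (le_max_left _ _).trans_lt hq1, hq2, ?_, hq'1, fun k hk1 hk2 => ?_⟩
  · linarith [(le_max_right (0 : ℝ) (runningMean z n - m)).trans_lt hq1]
  · linarith [hy k (Finset.mem_Ico.2 ⟨hk1, hk2⟩)]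

end Threshold

/-! ### Existence and bound of the limit, and inconsistency. -/

/-- The limit is 0 if C(·/σ) stays above `max 1 c`, and otherwise the probability that alternative
`0` stays above `m + t` for the crossing point `t`; the bound is just `t > 0`. -/
theorem exists_tendsto_greedyPCS {Ω : Type*} [MeasurableSpace Ω] {P : Measure Ω}
    [IsProbabilityMeasure P] {X : ℕ → ℕ → Ω → ℝ} {sel : ℕ → (ℕ → ℝ) → ℕ} {m m0 σ c : ℝ}
    (hmeas : ∀ i j, Measurable (X i j))
    (hindep : iIndepFun (fun p : ℕ × ℕ => X p.1 p.2) P) (hσ : 0 < σ)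
    (hlaw0 : ∀ j, P.map (X 0 j) = gaussianReal m0 (σ ^ 2).toNNReal)
    (hlaw : ∀ i j, P.map (X (i + 1) j) = gaussianReal m (σ ^ 2).toNNReal)
    (hsel : IsArgmaxRule sel) (hc : 0 ≤ c) :
    ∃ L : ℝ, Tendsto (fun k : ℕ => greedyPCS P X sel k ⌊c * (k : ℝ)⌋₊) atTop (𝓝 L) ∧
      L ≤ P.real {ω | ∀ n, 1 ≤ n → m < runningMean (fun j => X 0 j ω) n} := by
  rcases boundaryC_threshold hσ (max 1 c) with hall | ⟨t, ht, hgt, hlt⟩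
  · refine ⟨P.real ∅, tendsto_greedyPCS hmeas hindep hσ hlaw0 hlaw hsel hc MeasurableSet.empty
      (ae_of_all _ fun ω h => h.elim) (ae_of_all _ fun ω _ => ?_),
      measureReal_mono (Set.empty_subset _)⟩
    -- Any level above the first observation is already out of reach of the budget, so the passage
    -- occurs at `n = 1`.
    obtain ⟨q, hq⟩ := exists_rat_gt (max 0 (runningMean (fun j => X 0 j ω) 1 - m))
    have hq0 : (0 : ℝ) < q := (le_max_left _ _).trans_lt hq
    refine ⟨q, 0, 1, le_rfl, hq0, hall q hq0, ?_, Or.inl rfl⟩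
    linarith [(le_max_right (0 : ℝ) (runningMean (fun j => X 0 j ω) 1 - m)).trans_lt hq]
  · have hrm : ∀ n, Measurable fun ω => runningMean (fun j => X 0 j ω) n := fun n =>
      (measurable_runningMean n).comp (measurable_pi_lambda _ (hmeas 0))
    refine ⟨P.real {ω | ∀ n, 1 ≤ n → m + t < runningMean (fun j => X 0 j ω) n},
      tendsto_greedyPCS hmeas hindep hσ hlaw0 hlaw hsel hc (by measurability) ?_ ?_,
      measureReal_mono fun ω h n hn => ?_⟩
    · filter_upwards [ae_tendsto_runningMean (hmeas 0) (iIndepFun_row hindep 0) hlaw0,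
        ae_exists_runningMean_lt (hmeas 0) (iIndepFun_row hindep 0) hσ hlaw0] with ω h1 h2 hω
      -- The minimum is attained, so it lies strictly above `m + t`, and a rational level fits in
      -- between.
      obtain ⟨M, hM1, hM2, -⟩ := exists_last_argmin h1 h2
      have h3 : m + t < runningMean (fun j => X 0 j ω) M := hω M hM1
      obtain ⟨q, hq1, hq2⟩ := exists_rat_btwn (lt_sub_iff_add_lt'.2 h3)
      exact ⟨q, ht.trans hq1, hgt q hq1, fun n hn => by linarith [hM2 n hn]⟩
    · filter_upwards [ae_runningMean_ne (hmeas 0) (iIndepFun_row hindep 0) hσ hlaw0 (m + t)]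
        with ω hne hω
      have hex : ∃ n, 1 ≤ n ∧ runningMean (fun j => X 0 j ω) n ≤ m + t := by
        by_contra hcon
        exact hω fun n hn => not_le.1 fun h => hcon ⟨n, hn, h⟩
      obtain ⟨q, q', n, hn, hq, hqt, hle, hq', habove⟩ := exists_rat_first_passage ht hne hex
      exact ⟨q, q', n, hn, hq, hlt q hq hqt, hle, Or.inr ⟨ht.trans hq', hgt q' hq', habove⟩⟩
    · have : m + t < runningMean (fun j => X 0 j ω) n := h n hn
      linarith

theorem corollary1 {Ω : Type*} [MeasurableSpace Ω] (P : Measure Ω) [IsProbabilityMeasure P]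
    (X : ℕ → ℕ → Ω → ℝ) (μ : ℕ → ℝ) (γ σ : ℝ) (hγ : 0 < γ) (hσ : 0 < σ)
    (hmean : ∀ i : ℕ, 1 ≤ i → μ 0 - μ i = γ)
    (hmeas : ∀ i j : ℕ, Measurable (X i j))
    (hlaw : ∀ i j : ℕ, P.map (X i j) = gaussianReal (μ i) (σ ^ 2).toNNReal)
    (hindep : iIndepFun (fun p : ℕ × ℕ => X p.1 p.2) P)
    (sel : ℕ → (ℕ → ℝ) → ℕ) (hsel : IsArgmaxRule sel) :
    (∀ c : ℝ, boundaryC (γ / σ) < c →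
      ∃ L : ℝ, Tendsto (fun k : ℕ => greedyPCS P X sel k ⌊c * (k : ℝ)⌋₊) atTop (𝓝 L) ∧
        L ≤ P.real {ω | MinRunningMeanGT (fun j => X 0 j ω) (μ 0 - γ)}) ∧
    P.real {ω | MinRunningMeanGT (fun j => X 0 j ω) (μ 0 - γ)} = (boundaryC (γ / σ))⁻¹ ∧
    (boundaryC (γ / σ))⁻¹ < 1 ∧
    ¬ IsConsistent (greedyPCS P X sel) := by
  have hlaw' : ∀ i j, P.map (X (i + 1) j) = gaussianReal (μ 0 - γ) (σ ^ 2).toNNReal := fun i j => by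
    rw [hlaw, ← hmean (i + 1) (by omega), sub_sub_cancel]
  have hmin : P.real {ω | MinRunningMeanGT (fun j => X 0 j ω) (μ 0 - γ)} =
      P.real {ω | ∀ n, 1 ≤ n → μ 0 - γ < runningMean (fun j => X 0 j ω) n} := by
    refine measureReal_congr ?_
    filter_upwards [ae_tendsto_runningMean (hmeas 0) (iIndepFun_row hindep 0) (hlaw 0),
      ae_exists_runningMean_lt (hmeas 0) (iIndepFun_row hindep 0) hσ (hlaw 0)] with ω h1 h2
    exact propext (minRunningMeanGT_iff h1 h2)
  have hval := real_forall_lt_runningMean (hmeas 0) (iIndepFun_row hindep 0) hσ (hlaw 0) hγ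
  have hC : 1 < boundaryC (γ / σ) := one_lt_boundaryC (div_pos hγ hσ)
  have hC1 : (boundaryC (γ / σ))⁻¹ < 1 := inv_lt_one_of_one_lt₀ hC
  -- Needed for every positive `c`, since consistency may use any of them.
  have hlim : ∀ c : ℝ, 0 < c → ∃ L : ℝ,
      Tendsto (fun k : ℕ => greedyPCS P X sel k ⌊c * (k : ℝ)⌋₊) atTop (𝓝 L) ∧
        L ≤ P.real {ω | MinRunningMeanGT (fun j => X 0 j ω) (μ 0 - γ)} := fun c hc => by
    rw [hmin]
    exact exists_tendsto_greedyPCS hmeas hindep hσ (hlaw 0) hlaw' hsel hc.le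
  refine ⟨fun c hc => hlim c (by linarith), hmin.trans hval, hC1, fun hcons => ?_⟩
  -- Any target strictly between 1/C(γ/σ) and 1 exceeds every attainable limit.
  obtain ⟨α, hα1, hα2⟩ := exists_between hC1
  obtain ⟨c, hc, hle⟩ := hcons α ⟨(inv_pos.2 (by linarith)).trans hα1, hα2⟩
  obtain ⟨L, hL, hLle⟩ := hlim c hc
  rw [hL.liminf_eq] at hle
  rw [hmin, hval] at hLle
  linarith
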